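/- Let $\kappa,\ell>0$, $\mathbb D=\{(a_1,a_2)\in\mathbb R^2: a_1^2+a_2^2<\kappa^2\}$, $\Omega=\mathbb D\times(0,\ell)$, and let $S_F=\{a\in\partial\Omega: a_1^2+a_2^2=\kappa^2\}$ be the lateral surface. All functions are complex-valued, and $\mathbf L^2=L^2(\Omega)^3$ carries the inner product $(\mathbf u,\mathbf v)=\int_\Omega \mathbf u\cdot\overline{\mathbf v}$. Let $\mathbf P^0$ be the space of those $\mathbf u\in\mathbf L^2$ whose $\ell$-periodic extension in the $a_3$-direction is divergence-free in the sense of distributions on the infinite cylinder $\mathbb D\times\mathbb R$ (equivalently, on the solid torus obtained by identifying the two faces of $\Omega$), i.e. $\int_\Omega \mathbf u\cdot\nabla\varphi=0$ for every smooth function $\varphi$ on $\mathbb D\times\mathbb R$ that is $\ell$-periodic in $a_3$ and vanishes for $a_1^2+a_2^2>r$ for some $r<\kappa^2$. For $q\in L^2(\Omega)$ let $\hat q_n(a_1,a_2)=\frac1\ell\int_0^\ell q(a_1,a_2,a_3)e^{-2\pi i n a_3/\ell}\,da_3$. Let $H^1_{\mathrm p}$ be the space of all $q\in H^1(\Omega)$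 such that $\hat q_n\in H^1(\mathbb D)$ for all $n\in\mathbb Z$ and $$\sum_{n\in\mathbb Z}\Big(\ell\,\|\hat q_n\|_{H^1(\mathbb D)}^2+\frac{(2\pi n)^2}{\ell}\,\|\hat q_n\|_{L^2(\mathbb D)}^2\Big)<\infty ,$$ and let ${}^0H^1_{\mathrm p}=\{q\in H^1_{\mathrm p}: q=0 \text{ on } S_F\}$, where the boundary value is understood in the sense of traces. Then the orthogonal complement of $\mathbf P^0$ in $\mathbf L^2$ is $$(\mathbf P^0)^\perp=\{\nabla q: q\in {}^0H^1_{\mathrm p}\}.$$ Consequently every $\mathbf w\in\mathbf L^2$ can be written as $\mathbf w=\mathbf u+\nabla q$ with unique $\mathbf u\in\mathbf P^0$ and $q\in{}^0H^1_{\mathrm p}$. -/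

import Mathlib

open MeasureTheory Filter Topology
open scoped ContDiff InnerProductSpace

noncomputable section

namespace Jet

/-- Euclidean `d`-space. -/
abbrev E (d : ℕ) : Type := EuclideanSpace ℝ (Fin d)

/-- The partial derivative `D_i φ` of a function that is differentiable in the classical sense. -/
def pderiv {d : ℕ} (i : Fin d) (φ : E d → ℂ) (x : E d) : ℂ :=
  fderiv ℝ φ x (EuclideanSpace.single i 1)

/-- The open disk of radius `κ` about the origin of the plane. -/
def disk (κ : ℝ) : Set (E 2) := {y | y 0 ^ 2 + y 1 ^ 2 < κ ^ 2}

/-- The open cylinder `Ω`, the product of the disk of radius `κ` and the interval `(0, ℓ)`. -/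
def cylinder (κ ℓ : ℝ) : Set (E 3) :=
  {x | x 0 ^ 2 + x 1 ^ 2 < κ ^ 2 ∧ 0 < x 2 ∧ x 2 < ℓ}

/-- `g = D_i f` on the open set `U` in the sense of distributions. -/
def HasWeakDeriv {d : ℕ} (U : Set (E d)) (i : Fin d) (f g : E d → ℂ) : Prop :=
  ∀ φ : E d → ℂ, ContDiff ℝ ∞ φ → HasCompactSupport φ → tsupport φ ⊆ U →
    ∫ x in U, f x * pderiv i φ x = - ∫ x in U, g x * φ x

/-- `f` belongs to the Sobolev space `H¹(U) = W^{1,2}(U)` of complex-valued functions, and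
`G 0, …, G (d - 1)` are its weak first derivatives. -/
def HasH1Grad {d : ℕ} (U : Set (E d)) (f : E d → ℂ) (G : Fin d → E d → ℂ) : Prop :=
  MemLp f 2 (volume.restrict U) ∧
    ∀ i, MemLp (G i) 2 (volume.restrict U) ∧ HasWeakDeriv U i f (G i)

/-- `L²(Ω)`, complex-valued. -/
abbrev L2 (κ ℓ : ℝ) : Type := Lp ℂ 2 (volume.restrict (cylinder κ ℓ))

/-- `L²(Ω)³`, with the inner product `∫_Ω ∑ i, conj (u i) * v i`. -/
abbrev L2Vec (κ ℓ : ℝ) : Type :=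
  Lp (EuclideanSpace ℂ (Fin 3)) 2 (volume.restrict (cylinder κ ℓ))

/-- `w` is the (weak) gradient of `q` in `Ω`. -/
def IsGradient {κ ℓ : ℝ} (q : L2 κ ℓ) (w : L2Vec κ ℓ) : Prop :=
  ∀ i, HasWeakDeriv (cylinder κ ℓ) i q (fun x => w x i)

/-- The `n`-th Fourier coefficient of `f` in the axial variable:
`f̂_n (a₁, a₂) = ℓ⁻¹ ∫_0^ℓ f (a₁, a₂, a₃) exp (-2π i n a₃ / ℓ) da₃`. -/
def axialCoeff (ℓ : ℝ) (f : E 3 → ℂ) (n : ℤ) (y : E 2) : ℂ :=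
  (ℓ : ℂ)⁻¹ * ∫ z in (0 : ℝ)..ℓ,
    f !₂[y 0, y 1, z] * Complex.exp (-(2 * Real.pi * Complex.I * n * z / ℓ))

/-- The space `H¹_p` of functions in `H¹(Ω)` that are periodic in the axial variable: all Fourier
coefficients `q̂_n` are in `H¹` of the disk `D`, and
`∑ n, (ℓ ‖q̂_n‖²_{H¹(D)} + (2πn)² / ℓ ‖q̂_n‖²_{L²(D)}) < ∞`. -/
def H1p (κ ℓ : ℝ) : Set (L2 κ ℓ) :=
  {q | (∃ G, HasH1Grad (cylinder κ ℓ) q G) ∧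
    ∃ G : ℤ → Fin 2 → E 2 → ℂ,
      (∀ n, HasH1Grad (disk κ) (axialCoeff ℓ q n) (G n)) ∧
      Summable fun n : ℤ =>
        ℓ * ((∫ y in disk κ, ‖axialCoeff ℓ q n y‖ ^ 2) + ∑ i, ∫ y in disk κ, ‖G n i y‖ ^ 2) +
        (2 * Real.pi * n) ^ 2 / ℓ * ∫ y in disk κ, ‖axialCoeff ℓ q n y‖ ^ 2}

/-- `f ∈ H¹(Ω)` has the trace `g` on the lateral surface `S_F`: some functions `φ k`, smooth up to
the boundary, converge to `f` in `H¹(Ω)`, and their restrictions to `S_F` converge to `g` in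
`L²(S_F)`. The surface is parametrized by `(θ, z) ↦ (κ cos θ, κ sin θ, z)`, with surface
element `κ dθ dz`. -/
def HasLateralTrace (κ ℓ : ℝ) (f g : E 3 → ℂ) : Prop :=
  ∃ G, HasH1Grad (cylinder κ ℓ) f G ∧
    ∃ φ : ℕ → E 3 → ℂ, (∀ k, ContDiff ℝ ∞ (φ k)) ∧
      Tendsto (fun k => eLpNorm (fun x => φ k x - f x) 2 (volume.restrict (cylinder κ ℓ)))
        atTop (𝓝 0) ∧
      (∀ i, Tendsto
        (fun k => eLpNorm (fun x => pderiv i (φ k) x - G i x) 2 (volume.restrict (cylinder κ ℓ)))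
        atTop (𝓝 0)) ∧
      Tendsto
        (fun k => ∫⁻ p in Set.Ioo (0 : ℝ) (2 * Real.pi) ×ˢ Set.Ioo (0 : ℝ) ℓ,
          ‖φ k !₂[κ * Real.cos p.1, κ * Real.sin p.1, p.2] -
            g !₂[κ * Real.cos p.1, κ * Real.sin p.1, p.2]‖ₑ ^ 2 * ENNReal.ofReal κ)
        atTop (𝓝 0)

/-- The space `⁰H¹_p` of the functions in `H¹_p` that vanish on `S_F`. -/
def H1pZero (κ ℓ : ℝ) : Set (L2 κ ℓ) :=
  {q | q ∈ H1p κ ℓ ∧ HasLateralTrace κ ℓ q (fun _ => 0)}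

/-- Test functions on the solid torus obtained from the closure of `Ω` by identifying its two
faces, that is, smooth functions on the infinite cylinder that are `ℓ`-periodic in the axial
variable and vanish near the lateral surface. (They are extended by zero to the whole space.) -/
def IsPeriodicTest (κ ℓ : ℝ) (φ : E 3 → ℂ) : Prop :=
  ContDiff ℝ ∞ φ ∧ (∀ x, φ (x + EuclideanSpace.single 2 ℓ) = φ x) ∧
    ∃ r < κ ^ 2, ∀ x, φ x ≠ 0 → x 0 ^ 2 + x 1 ^ 2 ≤ r

theorem cylinder_subset_compact (κ ℓ : ℝ) :
    ∃ K : Set (E 3), IsCompact K ∧ cylinder κ ℓ ⊆ K := by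
  refine ⟨Metric.closedBall 0 (|κ| + |ℓ|), isCompact_closedBall _ _, fun x hx => ?_⟩
  obtain ⟨h1, h2, h3⟩ := hx
  rw [mem_closedBall_zero_iff, EuclideanSpace.norm_eq, Real.sqrt_le_left (by positivity)]
  simp only [Fin.sum_univ_three, Real.norm_eq_abs, sq_abs]
  have h4 : x 2 ≤ |ℓ| := h3.le.trans (le_abs_self _)
  nlinarith [sq_abs κ, sq_abs ℓ, abs_nonneg κ, abs_nonneg ℓ,
    mul_nonneg (abs_nonneg κ) (abs_nonneg ℓ)]

theorem measurableSet_cylinder (κ ℓ : ℝ) : MeasurableSet (cylinder κ ℓ) := by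
  have hc : ∀ i : Fin 3, Continuous fun x : E 3 => x i := fun i => by fun_prop
  have h0 : IsOpen (cylinder κ ℓ) :=
    (isOpen_lt (((hc 0).pow 2).add ((hc 1).pow 2)) continuous_const).inter
      ((isOpen_lt continuous_const (hc 2)).inter (isOpen_lt (hc 2) continuous_const))
  exact h0.measurableSet

theorem integrable_mul_pderiv {κ ℓ : ℝ} {φ : E 3 → ℂ} (hφ : ContDiff ℝ ∞ φ) (u : L2Vec κ ℓ)
    (i : Fin 3) :
    Integrable (fun x => u x i * pderiv i φ x) (volume.restrict (cylinder κ ℓ)) := by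
  obtain ⟨K, hK, hsub⟩ := cylinder_subset_compact κ ℓ
  have : IsFiniteMeasure (volume.restrict (cylinder κ ℓ)) :=
    ⟨by rw [Measure.restrict_apply_univ]; exact (measure_mono hsub).trans_lt hK.measure_lt_top⟩
  have hc : Continuous (pderiv i φ) := by
    have h1 : Continuous (fderiv ℝ φ) := hφ.continuous_fderiv (by simp)
    exact h1.clm_apply continuous_const
  obtain ⟨C, hC⟩ := hK.exists_bound_of_continuousOn hc.continuousOn
  have hu : Integrable (fun x => u x i) (volume.restrict (cylinder κ ℓ)) :=
    ((EuclideanSpace.proj (𝕜 := ℂ) i).integrable_comp ((Lp.memLp u).integrable (by norm_num)))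
  refine hu.mul_bdd (c := C) hc.aestronglyMeasurable ?_
  filter_upwards [ae_restrict_mem (measurableSet_cylinder κ ℓ)] with x hx
  exact hC x (hsub hx)

/-- The space `P⁰` of the fields `u ∈ L²(Ω)³` whose periodic extension is divergence-free, that is,
`∇ · u = 0` in the sense of distributions on the solid torus. -/
def P0 (κ ℓ : ℝ) : Submodule ℂ (L2Vec κ ℓ) where
  carrier := {u | ∀ φ, IsPeriodicTest κ ℓ φ →
    ∫ x in cylinder κ ℓ, ∑ i, u x i * pderiv i φ x = 0}
  zero_mem' := by
    intro φ _
    rw [← integral_zero (E 3) ℂ (μ := volume.restrict (cylinder κ ℓ))]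
    refine integral_congr_ae ?_
    filter_upwards [Lp.coeFn_zero (EuclideanSpace ℂ (Fin 3)) 2
      (volume.restrict (cylinder κ ℓ))] with x hx
    refine Finset.sum_eq_zero fun i _ => ?_
    rw [hx]
    exact zero_mul _
  add_mem' := by
    intro u v hu hv φ hφ
    have h : ∫ x in cylinder κ ℓ, ∑ i, (u + v) x i * pderiv i φ x =
        ∫ x in cylinder κ ℓ, ((∑ i, u x i * pderiv i φ x) + ∑ i, v x i * pderiv i φ x) := by
      refine integral_congr_ae ?_
      filter_upwards [Lp.coeFn_add u v] with x hx
      rw [← Finset.sum_add_distrib]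
      refine Finset.sum_congr rfl fun i _ => ?_
      rw [hx]
      exact add_mul _ _ _
    rw [h, integral_add (integrable_finsetSum _ fun i _ => integrable_mul_pderiv hφ.1 u i)
      (integrable_finsetSum _ fun i _ => integrable_mul_pderiv hφ.1 v i), hu φ hφ, hv φ hφ, add_zero]
  smul_mem' := by
    intro c u hu φ hφ
    have h : ∫ x in cylinder κ ℓ, ∑ i, (c • u) x i * pderiv i φ x =
        ∫ x in cylinder κ ℓ, c * ∑ i, u x i * pderiv i φ x := by
      refine integral_congr_ae ?_
      filter_upwards [Lp.coeFn_smul c u] with x hx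
      rw [Finset.mul_sum]
      refine Finset.sum_congr rfl fun i _ => ?_
      rw [hx]
      exact mul_assoc _ _ _
    rw [h, integral_const_mul, hu φ hφ, mul_zero]

end Jet

end

/-!
The space `P⁰` is, by definition and because the conjugate of a test function is a test function,
the orthogonal complement of the space `testGradients` of gradients of periodic test functions
(`P0_eq_orthogonal`). Hence `(P⁰)ᗮ` is the closure of `testGradients`, and the first claim says
that this closure consists of the gradients of the functions in `⁰H¹_p`. Both inclusions go through
the condition `HasGreenDeriv`: integration by parts in `Ω` holds, without boundary terms, against
every smooth function `χ` with equal values on the two faces. It is a weak form of the statement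
that `q` is periodic in the axial variable and vanishes on the lateral surface.

*The closure consists of gradients* (`exists_of_mem_closure`). The divergence theorem for
`x₀ |φ|²` gives Poincaré's inequality `lintegral_cylinder_le`, so that test functions whose
gradients converge also converge. The condition `HasGreenDeriv` passes to the limit, and testing it
with `ψ(y) exp (-2π i n z / ℓ)` yields the weak derivatives of the Fourier coefficients;
Bessel's inequality then gives membership in `H¹_p`. The test functions themselves show that the
lateral trace is zero.

*Gradients lie in the closure.* For `q ∈ ⁰H¹_p` the condition `HasGreenDeriv` holds
(`hasGreenDeriv_of_mem_H1pZero`). In the horizontal directions this is the divergence theorem for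
the smooth approximations from the definition of the trace. In the axial direction the defect of
integration by parts depends only on the common values of `χ` on the faces, so `χ` may be replaced
by modes of arbitrarily high frequency with the same face values, for which the defect tends to
zero by the decay of `n q̂_n`. Finally `HasGreenDeriv` makes mollification of the periodic
extension (by zero across the lateral surface) commute with differentiation, and after a slight
horizontal dilation the mollifications are periodic test functions whose gradients converge to that
of `q` (`mem_closure_of_hasGreenDeriv`).

The decomposition is the orthogonal projection onto `P⁰`; that `q` is determined by its gradient is
Poincaré's inequality once more (`eq_of_isGradient`).
-/

noncomputable section

namespace Jet

/-! ### Cylindrical and polar coordinates -/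

/-- Cylindrical coordinates `(y, z) ↦ (y₀, y₁, z)`, splitting off the axial variable. -/
def cylEquiv : (E 2 × ℝ) ≃ᵐ E 3 where
  toFun p := !₂[p.1 0, p.1 1, p.2]
  invFun x := (!₂[x 0, x 1], x 2)
  left_inv p := by
    refine Prod.ext ?_ rfl
    ext i; fin_cases i <;> rfl
  right_inv x := by ext i; fin_cases i <;> rfl
  measurable_toFun := by
    refine (PiLp.continuous_toLp 2 _).measurable.comp (measurable_pi_iff.2 fun i => ?_)
    fin_cases i <;> simp <;> fun_prop
  measurable_invFun := by
    refine Measurable.prodMk ((PiLp.continuous_toLp 2 _).measurable.comp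
      (measurable_pi_iff.2 fun i => ?_)) ?_
    · fin_cases i <;> simp <;> fun_prop
    · fun_prop

theorem measurePreserving_cylEquiv : MeasurePreserving cylEquiv := by
  have h1 : MeasurePreserving (fun p : E 2 × ℝ => (p.2, (WithLp.ofLp p.1 : Fin 2 → ℝ))) := by
    have := (PiLp.volume_preserving_ofLp (Fin 2)).prod (MeasurePreserving.id (volume : Measure ℝ))
    exact (Measure.measurePreserving_swap).comp this
  have h2 := (volume_preserving_piFinSuccAbove (fun _ : Fin 3 => ℝ) (Fin.last 2)).symm
  have h3 := PiLp.volume_preserving_toLp (Fin 3)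
  have h := h3.comp (h2.comp h1)
  convert h using 1
  funext p
  ext i
  fin_cases i <;> rfl

theorem preimage_cylEquiv_cylinder (κ ℓ : ℝ) :
    cylEquiv ⁻¹' cylinder κ ℓ = disk κ ×ˢ Set.Ioo 0 ℓ := rfl

theorem isOpen_cylinder (κ ℓ : ℝ) : IsOpen (cylinder κ ℓ) := by
  have hc : ∀ i : Fin 3, Continuous fun x : E 3 => x i := fun i => by fun_prop
  exact (isOpen_lt (((hc 0).pow 2).add ((hc 1).pow 2)) continuous_const).inter
      ((isOpen_lt continuous_const (hc 2)).inter (isOpen_lt (hc 2) continuous_const))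

theorem isOpen_disk (κ : ℝ) : IsOpen (disk κ) := by
  have hc : ∀ i : Fin 2, Continuous fun x : E 2 => x i := fun i => by fun_prop
  exact isOpen_lt (((hc 0).pow 2).add ((hc 1).pow 2)) continuous_const

theorem disk_subset_closedBall (κ : ℝ) : disk κ ⊆ Metric.closedBall 0 |κ| := by
  intro x hx
  rw [mem_closedBall_zero_iff, EuclideanSpace.norm_eq, Real.sqrt_le_left (by positivity)]
  simp only [Fin.sum_univ_two, Real.norm_eq_abs, sq_abs]
  exact le_of_lt hx

instance (κ : ℝ) : IsFiniteMeasure (volume.restrict (disk κ)) :=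
  ⟨by rw [Measure.restrict_apply_univ]
      exact (measure_mono (disk_subset_closedBall κ)).trans_lt
        (isCompact_closedBall _ _).measure_lt_top⟩

instance (κ ℓ : ℝ) : IsFiniteMeasure (volume.restrict (cylinder κ ℓ)) := by
  obtain ⟨K, hK, hsub⟩ := cylinder_subset_compact κ ℓ
  exact ⟨by rw [Measure.restrict_apply_univ]; exact (measure_mono hsub).trans_lt hK.measure_lt_top⟩

theorem measurePreserving_cylEquiv_restrict (κ ℓ : ℝ) :
    MeasurePreserving cylEquiv ((volume.restrict (disk κ)).prod (volume.restrict (Set.Ioo 0 ℓ)))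
      (volume.restrict (cylinder κ ℓ)) := by
  have h := measurePreserving_cylEquiv.restrict_preimage_emb cylEquiv.measurableEmbedding
    (cylinder κ ℓ)
  rwa [preimage_cylEquiv_cylinder, Measure.volume_eq_prod, ← Measure.prod_restrict] at h

theorem integral_cylinder (κ ℓ : ℝ) {f : E 3 → ℂ}
    (hf : Integrable f (volume.restrict (cylinder κ ℓ))) :
    ∫ x in cylinder κ ℓ, f x = ∫ y in disk κ, ∫ z in Set.Ioo 0 ℓ, f !₂[y 0, y 1, z] := by
  have h := measurePreserving_cylEquiv_restrict κ ℓ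
  rw [← h.integral_comp cylEquiv.measurableEmbedding, integral_prod]
  · rfl
  · exact (h.integrable_comp_emb cylEquiv.measurableEmbedding).2 hf

theorem integral_cylinder_symm (κ ℓ : ℝ) {f : E 3 → ℂ}
    (hf : Integrable f (volume.restrict (cylinder κ ℓ))) :
    ∫ x in cylinder κ ℓ, f x = ∫ z in Set.Ioo 0 ℓ, ∫ y in disk κ, f !₂[y 0, y 1, z] := by
  have h := measurePreserving_cylEquiv_restrict κ ℓ
  rw [← h.integral_comp cylEquiv.measurableEmbedding, integral_prod_symm]
  · rfl
  · exact (h.integrable_comp_emb cylEquiv.measurableEmbedding).2 hf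

theorem lintegral_cylinder (κ ℓ : ℝ) {f : E 3 → ENNReal}
    (hf : AEMeasurable f (volume.restrict (cylinder κ ℓ))) :
    ∫⁻ x in cylinder κ ℓ, f x = ∫⁻ y in disk κ, ∫⁻ z in Set.Ioo 0 ℓ, f !₂[y 0, y 1, z] := by
  have h := measurePreserving_cylEquiv_restrict κ ℓ
  rw [← h.lintegral_comp_emb cylEquiv.measurableEmbedding, lintegral_prod]
  · rfl
  · exact hf.comp_quasiMeasurePreserving h.quasiMeasurePreserving

theorem integrable_cylinder_of_continuous {G : Type*} [NormedAddCommGroup G] (κ ℓ : ℝ) {f : E 3 → G}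
    (hf : Continuous f) :
    Integrable f (volume.restrict (cylinder κ ℓ)) := by
  obtain ⟨K, hK, hsub⟩ := cylinder_subset_compact κ ℓ
  exact (hf.continuousOn.integrableOn_compact hK).mono_set hsub

/-- Cartesian coordinates of the plane. -/
def planeEquiv : (ℝ × ℝ) ≃ᵐ E 2 where
  toFun p := !₂[p.1, p.2]
  invFun x := (x 0, x 1)
  left_inv p := rfl
  right_inv x := by ext i; fin_cases i <;> rfl
  measurable_toFun := by
    refine (PiLp.continuous_toLp 2 _).measurable.comp (measurable_pi_iff.2 fun i => ?_)
    fin_cases i <;> simp <;> fun_prop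
  measurable_invFun := by
    refine Measurable.prodMk ?_ ?_ <;> simp <;> fun_prop

@[simp] theorem planeEquiv_apply (p : ℝ × ℝ) : planeEquiv p = !₂[p.1, p.2] := rfl

theorem measurePreserving_planeEquiv : MeasurePreserving planeEquiv := by
  have h2 := (volume_preserving_finTwoArrow ℝ).symm
  have he : ⇑planeEquiv = WithLp.toLp 2 ∘ ⇑MeasurableEquiv.finTwoArrow.symm := by
    funext p
    ext i
    fin_cases i <;> rfl
  rw [he]
  exact (PiLp.volume_preserving_toLp (Fin 2)).comp h2

/-- Integration over a disk in polar coordinates. -/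
theorem integral_disk_polar {κ : ℝ} (hκ : 0 < κ) (g : E 2 → ℂ) :
    ∫ y in disk κ, g y = ∫ p in Set.Ioo 0 κ ×ˢ Set.Ioo (-Real.pi) Real.pi,
      (p.1 : ℂ) * g !₂[p.1 * Real.cos p.2, p.1 * Real.sin p.2] := by
  rw [← integral_indicator (isOpen_disk κ).measurableSet,
    ← measurePreserving_planeEquiv.integral_comp planeEquiv.measurableEmbedding,
    ← integral_comp_polarCoord_symm]
  have hs : Set.Ioo 0 κ ×ˢ Set.Ioo (-Real.pi) Real.pi =
      polarCoord.target ∩ {p | p.1 < κ} := by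
    ext p
    simp only [polarCoord_target, Set.mem_prod, Set.mem_Ioo, Set.mem_inter_iff, Set.mem_Ioi,
      Set.mem_ofPred_eq]
    tauto
  have hm : MeasurableSet {p : ℝ × ℝ | p.1 < κ} :=
    (isOpen_lt continuous_fst continuous_const).measurableSet
  rw [hs, ← setIntegral_indicator hm]
  refine setIntegral_congr_fun polarCoord.open_target.measurableSet fun p hp => ?_
  have h0 : 0 < p.1 := by simpa using hp.1
  have hiff : planeEquiv (polarCoord.symm p) ∈ disk κ ↔ p.1 < κ := by
    change (p.1 * Real.cos p.2) ^ 2 + (p.1 * Real.sin p.2) ^ 2 < κ ^ 2 ↔ _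
    have : (p.1 * Real.cos p.2) ^ 2 + (p.1 * Real.sin p.2) ^ 2 = p.1 ^ 2 := by
      nlinarith [Real.sin_sq_add_cos_sq p.2]
    rw [this]
    exact sq_lt_sq₀ h0.le hκ.le
  by_cases h : p.1 < κ
  · rw [Set.indicator_of_mem (hiff.2 h), Set.indicator_of_mem (show p ∈ {p : ℝ × ℝ | p.1 < κ} from h)]
    simp [polarCoord]
  · rw [Set.indicator_of_notMem (fun h' => h (hiff.1 h')),
      Set.indicator_of_notMem (show p ∉ {p : ℝ × ℝ | p.1 < κ} from h)]
    simp

/-! ### The divergence theorem and Poincaré's inequality on the cylinder -/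

theorem continuous_vec2 {X : Type*} [TopologicalSpace X] {a b : X → ℝ} (ha : Continuous a)
    (hb : Continuous b) : Continuous fun x => (!₂[a x, b x] : E 2) := by
  refine (PiLp.continuous_toLp 2 _).comp (continuous_pi fun i => ?_)
  fin_cases i
  · exact ha
  · exact hb

theorem continuous_vec3 {X : Type*} [TopologicalSpace X] {a b c : X → ℝ} (ha : Continuous a)
    (hb : Continuous b) (hc : Continuous c) : Continuous fun x => (!₂[a x, b x, c x] : E 3) := by
  refine (PiLp.continuous_toLp 2 _).comp (continuous_pi fun i => ?_)
  fin_cases i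
  · exact ha
  · exact hb
  · exact hc

theorem continuous_pderiv {d : ℕ} {φ : E d → ℂ} (hφ : ContDiff ℝ ∞ φ) (i : Fin d) :
    Continuous (pderiv i φ) :=
  (hφ.continuous_fderiv (by simp)).clm_apply continuous_const

theorem hasDerivAt_vec2 {a b : ℝ → ℝ} {a' b' t : ℝ} (ha : HasDerivAt a a' t)
    (hb : HasDerivAt b b' t) : HasDerivAt (fun t => (!₂[a t, b t] : E 2)) !₂[a', b'] t := by
  have h : HasDerivAt (fun t => (![a t, b t] : Fin 2 → ℝ)) ![a', b'] t := by
    rw [hasDerivAt_pi]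
    intro i
    fin_cases i
    · exact ha
    · exact hb
  exact ((PiLp.continuousLinearEquiv 2 ℝ (fun _ : Fin 2 => ℝ)).symm :
    (Fin 2 → ℝ) →L[ℝ] E 2).hasFDerivAt.comp_hasDerivAt t h

theorem integrableOn_rect {f : ℝ × ℝ → ℂ} (hf : Continuous f) (a b c d : ℝ) :
    IntegrableOn f (Set.Ioo a b ×ˢ Set.Ioo c d) :=
  (hf.continuousOn.integrableOn_compact (isCompact_Icc.prod isCompact_Icc)).mono_set
    (Set.prod_mono Set.Ioo_subset_Icc_self Set.Ioo_subset_Icc_self)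

theorem setIntegral_Ioo_eq_sub {f f' : ℝ → ℂ} {a b : ℝ} (hab : a ≤ b)
    (h : ∀ t, HasDerivAt f (f' t) t) (hc : Continuous f') :
    ∫ t in Set.Ioo a b, f' t = f b - f a := by
  rw [← integral_Ioc_eq_integral_Ioo, ← intervalIntegral.integral_of_le hab]
  exact intervalIntegral.integral_eq_sub_of_hasDerivAt (fun t _ => h t)
    (hc.intervalIntegrable _ _)

/-- The divergence theorem on a disk, for the constant direction `(a, b)`. In polar coordinates
`r ∂_{(a,b)} g = ∂_r (r N g) + ∂_θ (N' g)`, where `N = a cos θ + b sin θ` is the component of the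
outer normal. -/
theorem integral_disk_fderiv {κ : ℝ} (hκ : 0 < κ) {g : E 2 → ℂ} (hg : ContDiff ℝ ∞ g) (a b : ℝ) :
    ∫ y in disk κ, fderiv ℝ g y !₂[a, b] = ∫ θ in Set.Ioo (-Real.pi) Real.pi,
      ((κ * (a * Real.cos θ + b * Real.sin θ) : ℝ) : ℂ) *
        g !₂[κ * Real.cos θ, κ * Real.sin θ] := by
  set P : ℝ × ℝ → E 2 := fun p => !₂[p.1 * Real.cos p.2, p.1 * Real.sin p.2] with hP
  set N : ℝ → ℝ := fun θ => a * Real.cos θ + b * Real.sin θ with hN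
  set N' : ℝ → ℝ := fun θ => -(a * Real.sin θ) + b * Real.cos θ with hN'
  have hPc : Continuous P := continuous_vec2 (by fun_prop) (by fun_prop)
  have hgd : ∀ y, HasFDerivAt g (fderiv ℝ g y) y := fun y =>
    (hg.differentiable (by simp) y).hasFDerivAt
  have hgc : Continuous (fderiv ℝ g) := hg.continuous_fderiv (by simp)
  have hg0 : Continuous g := hg.continuous
  -- the radial and the angular derivative
  set A : ℝ × ℝ → ℂ := fun p => (N p.2 : ℂ) * g (P p) +
    ((p.1 * N p.2 : ℝ) : ℂ) * fderiv ℝ g (P p) !₂[Real.cos p.2, Real.sin p.2] with hA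
  set B : ℝ × ℝ → ℂ := fun p => -(N p.2 : ℂ) * g (P p) +
    (N' p.2 : ℂ) * fderiv ℝ g (P p) !₂[-(p.1 * Real.sin p.2), p.1 * Real.cos p.2] with hB
  have hNc : Continuous N := by fun_prop
  have hNc' : Continuous N' := by fun_prop
  have hv1 : Continuous fun p : ℝ × ℝ => (!₂[Real.cos p.2, Real.sin p.2] : E 2) :=
    continuous_vec2 (by fun_prop) (by fun_prop)
  have hv2 : Continuous fun p : ℝ × ℝ => (!₂[-(p.1 * Real.sin p.2), p.1 * Real.cos p.2] : E 2) :=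
    continuous_vec2 (by fun_prop) (by fun_prop)
  have hAc : Continuous A := by fun_prop
  have hBc : Continuous B := by fun_prop
  have hAd : ∀ θ r, HasDerivAt (fun r => ((r * N θ : ℝ) : ℂ) * g (P (r, θ))) (A (r, θ)) r := by
    intro θ r
    have h1 : HasDerivAt (fun r => P (r, θ)) !₂[Real.cos θ, Real.sin θ] r := by
      refine hasDerivAt_vec2 ?_ ?_ <;> simpa using (hasDerivAt_id r).mul_const _
    have h2 := (hgd (P (r, θ))).comp_hasDerivAt r h1
    have h3 : HasDerivAt (fun r : ℝ => ((r * N θ : ℝ) : ℂ)) (N θ : ℂ) r := by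
      have : HasDerivAt (fun r : ℝ => r * N θ) (N θ) r := by
        simpa using (hasDerivAt_id r).mul_const (N θ)
      exact this.ofReal_comp
    exact h3.mul h2
  have hBd : ∀ r θ, HasDerivAt (fun θ => (N' θ : ℂ) * g (P (r, θ))) (B (r, θ)) θ := by
    intro r θ
    have h1 : HasDerivAt (fun θ => P (r, θ)) !₂[-(r * Real.sin θ), r * Real.cos θ] θ := by
      refine hasDerivAt_vec2 ?_ ?_
      · simpa using (Real.hasDerivAt_cos θ).const_mul r
      · exact (Real.hasDerivAt_sin θ).const_mul r
    have h2 := (hgd (P (r, θ))).comp_hasDerivAt θ h1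
    have h3 : HasDerivAt (fun θ : ℝ => ((N' θ : ℝ) : ℂ)) ((-(N θ) : ℝ) : ℂ) θ := by
      have : HasDerivAt N' (-(N θ)) θ := by
        exact (((Real.hasDerivAt_sin θ).const_mul a).neg.add
          ((Real.hasDerivAt_cos θ).const_mul b)).congr_deriv (by simp only [hN]; ring)
      exact this.ofReal_comp
    exact (h3.mul h2).congr_deriv (by simp [hB])
  have hsum : ∀ p : ℝ × ℝ, (p.1 : ℂ) * fderiv ℝ g (P p) !₂[a, b] = A p + B p := by
    intro p
    have hlin : p.1 • (!₂[a, b] : E 2) = (p.1 * N p.2) • !₂[Real.cos p.2, Real.sin p.2] +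
        N' p.2 • !₂[-(p.1 * Real.sin p.2), p.1 * Real.cos p.2] := by
      have h1 := Real.sin_sq_add_cos_sq p.2
      have h2 : Real.cos p.2 ^ 2 = 1 - Real.sin p.2 ^ 2 := by linarith
      ext i
      fin_cases i
      · simp [hN, hN']; ring_nf; rw [h2]; ring
      · simp [hN, hN']; ring_nf; rw [h2]; ring
    have h3 := congrArg (fderiv ℝ g (P p)) hlin
    simp only [map_add, map_smul, Complex.real_smul] at h3
    rw [h3]
    simp only [hA, hB]
    ring
  rw [integral_disk_polar hκ]
  have h1 : ∫ p in Set.Ioo 0 κ ×ˢ Set.Ioo (-Real.pi) Real.pi,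
      (p.1 : ℂ) * fderiv ℝ g !₂[p.1 * Real.cos p.2, p.1 * Real.sin p.2] !₂[a, b] =
      (∫ p in Set.Ioo 0 κ ×ˢ Set.Ioo (-Real.pi) Real.pi, A p) +
        ∫ p in Set.Ioo 0 κ ×ˢ Set.Ioo (-Real.pi) Real.pi, B p := by
    rw [← integral_add (integrableOn_rect hAc _ _ _ _) (integrableOn_rect hBc _ _ _ _)]
    exact integral_congr_ae (Eventually.of_forall fun p => hsum p)
  have hpi : -Real.pi ≤ Real.pi := by linarith [Real.pi_pos]
  have h2 : ∫ p in Set.Ioo 0 κ ×ˢ Set.Ioo (-Real.pi) Real.pi, B p = 0 := by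
    rw [Measure.volume_eq_prod, setIntegral_prod _ (integrableOn_rect hBc _ _ _ _)]
    refine (integral_congr_ae (Eventually.of_forall fun r => ?_)).trans (integral_zero _ _)
    change ∫ θ in Set.Ioo (-Real.pi) Real.pi, B (r, θ) = 0
    rw [setIntegral_Ioo_eq_sub hpi (hBd r) (by fun_prop)]
    simp [hN', hP]
  have h3 : ∫ p in Set.Ioo 0 κ ×ˢ Set.Ioo (-Real.pi) Real.pi, A p =
      ∫ θ in Set.Ioo (-Real.pi) Real.pi, ((κ * N θ : ℝ) : ℂ) * g (P (κ, θ)) := by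
    have hi := integrableOn_rect hAc 0 κ (-Real.pi) Real.pi
    rw [IntegrableOn, Measure.volume_eq_prod, ← Measure.prod_restrict] at hi
    rw [Measure.volume_eq_prod, ← Measure.prod_restrict, integral_prod_symm _ hi]
    refine integral_congr_ae (Eventually.of_forall fun θ => ?_)
    change ∫ r in Set.Ioo 0 κ, A (r, θ) = _
    rw [setIntegral_Ioo_eq_sub hκ.le (hAd θ) (by fun_prop)]
    simp
  rw [h1, h2, h3, add_zero]

theorem contDiff_vec3 {F : Type*} [NormedAddCommGroup F] [NormedSpace ℝ F] {a b c : F → ℝ}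
    (ha : ContDiff ℝ ∞ a) (hb : ContDiff ℝ ∞ b) (hc : ContDiff ℝ ∞ c) :
    ContDiff ℝ ∞ fun x => (!₂[a x, b x, c x] : E 3) := by
  refine contDiff_euclidean.2 fun i => ?_
  fin_cases i
  · exact ha
  · exact hb
  · exact hc

theorem contDiff_coord {d : ℕ} (i : Fin d) : ContDiff ℝ ∞ fun x : E d => x i :=
  contDiff_euclidean.1 contDiff_id i

theorem fderiv_slice {F : E 3 → ℂ} (hF : ContDiff ℝ ∞ F) (y : E 2) (z a b : ℝ) :
    fderiv ℝ (fun y : E 2 => F !₂[y 0, y 1, z]) y !₂[a, b] =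
      fderiv ℝ F !₂[y 0, y 1, z] !₂[a, b, 0] := by
  have hline : HasDerivAt (fun t : ℝ => y + t • (!₂[a, b] : E 2)) !₂[a, b] 0 := by
    simpa using ((hasDerivAt_id (0 : ℝ)).smul_const (!₂[a, b] : E 2)).const_add y
  have hline' : HasDerivAt (fun t : ℝ => (!₂[y 0, y 1, z] : E 3) + t • (!₂[a, b, 0] : E 3))
      !₂[a, b, 0] 0 := by
    simpa using ((hasDerivAt_id (0 : ℝ)).smul_const (!₂[a, b, 0] : E 3)).const_add
      (!₂[y 0, y 1, z] : E 3)
  have hsl : ContDiff ℝ ∞ (fun y : E 2 => F !₂[y 0, y 1, z]) :=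
    hF.comp (contDiff_vec3 (contDiff_coord 0) (contDiff_coord 1) contDiff_const)
  have h1 := ((hsl.differentiable (by simp) (y + (0 : ℝ) • (!₂[a, b] : E 2))).hasFDerivAt).comp_hasDerivAt
    (0 : ℝ) hline
  have h2 := ((hF.differentiable (by simp)
    ((!₂[y 0, y 1, z] : E 3) + (0 : ℝ) • (!₂[a, b, 0] : E 3))).hasFDerivAt).comp_hasDerivAt
    (0 : ℝ) hline'
  have he : (fun y : E 2 => F !₂[y 0, y 1, z]) ∘ (fun t : ℝ => y + t • (!₂[a, b] : E 2)) =
      F ∘ fun t : ℝ => (!₂[y 0, y 1, z] : E 3) + t • (!₂[a, b, 0] : E 3) := by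
    funext t
    simp only [Function.comp]
    congr 1
    ext i
    fin_cases i <;> simp
  rw [he] at h1
  simpa using h1.unique h2


theorem setLIntegral_Ioo_shift {h : ℝ → ENNReal} {T : ℝ} (hT : 0 < T)
    (hh : Function.Periodic h T) (s t : ℝ) :
    ∫⁻ θ in Set.Ioo s (s + T), h θ = ∫⁻ θ in Set.Ioo t (t + T), h θ := by
  rw [restrict_Ioo_eq_restrict_Ioc, restrict_Ioo_eq_restrict_Ioc]
  refine (isAddFundamentalDomain_Ioc hT s).setLIntegral_eq (isAddFundamentalDomain_Ioc hT t) h ?_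
  rintro ⟨g, hg⟩ x
  obtain ⟨n, rfl⟩ := AddSubgroup.mem_zmultiples_iff.1 hg
  change h (n • T + x) = h x
  rw [add_comm]
  exact hh.zsmul n x

/-- The divergence theorem on the cylinder, for a constant horizontal field: only the lateral
surface contributes. -/
theorem enorm_integral_cylinder_fderiv_le {κ : ℝ} (hκ : 0 < κ) (ℓ : ℝ) {F : E 3 → ℂ}
    (hF : ContDiff ℝ ∞ F) {a b : ℝ} (hab : a ^ 2 + b ^ 2 ≤ 1) :
    ‖∫ x in cylinder κ ℓ, fderiv ℝ F x !₂[a, b, 0]‖ₑ ≤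
      ∫⁻ p in Set.Ioo (0 : ℝ) (2 * Real.pi) ×ˢ Set.Ioo (0 : ℝ) ℓ,
        ‖F !₂[κ * Real.cos p.1, κ * Real.sin p.1, p.2]‖ₑ * ENNReal.ofReal κ := by
  have hc : Continuous fun x => fderiv ℝ F x !₂[a, b, 0] :=
    (hF.continuous_fderiv (by simp)).clm_apply continuous_const
  have hFc : Continuous fun p : ℝ × ℝ => F !₂[κ * Real.cos p.1, κ * Real.sin p.1, p.2] :=
    hF.continuous.comp (continuous_vec3 (by fun_prop) (by fun_prop) (by fun_prop))
  rw [integral_cylinder_symm κ ℓ (integrable_cylinder_of_continuous κ ℓ hc),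
    Measure.volume_eq_prod, ← Measure.prod_restrict, lintegral_prod_symm']
  swap
  · exact (hFc.enorm.measurable).mul_const _
  refine (enorm_integral_le_lintegral_enorm _).trans (lintegral_mono fun z => ?_)
  have hsl : ContDiff ℝ ∞ (fun y : E 2 => F !₂[y 0, y 1, z]) :=
    hF.comp (contDiff_vec3 (contDiff_coord 0) (contDiff_coord 1) contDiff_const)
  have h1 := integral_disk_fderiv hκ hsl a b
  simp only [fderiv_slice hF] at h1
  dsimp only
  rw [h1]
  refine (enorm_integral_le_lintegral_enorm _).trans ?_
  have hs := setLIntegral_Ioo_shift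
    (h := fun θ => ‖F !₂[κ * Real.cos θ, κ * Real.sin θ, z]‖ₑ * ENNReal.ofReal κ)
    Real.two_pi_pos (fun θ => by simp) 0 (-Real.pi)
  rw [zero_add, show -Real.pi + 2 * Real.pi = Real.pi by ring] at hs
  rw [hs]
  refine lintegral_mono fun θ => ?_
  simp only [Matrix.cons_val_zero, Matrix.cons_val_one]
  rw [enorm_mul, mul_comm]
  gcongr
  rw [← ofReal_norm, Complex.norm_real, Real.norm_eq_abs, abs_mul, abs_of_pos hκ]
  refine ENNReal.ofReal_le_ofReal ?_
  have : |a * Real.cos θ + b * Real.sin θ| ≤ 1 := by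
    rw [← sq_le_one_iff_abs_le_one]
    have h2 := Real.sin_sq_add_cos_sq θ
    nlinarith [sq_nonneg (a * Real.sin θ - b * Real.cos θ), sq_nonneg (a), sq_nonneg b]
  nlinarith

theorem single_castSucc_eq (i : Fin 2) : (EuclideanSpace.single i.castSucc 1 : E 3) =
    !₂[(EuclideanSpace.single i 1 : E 2) 0, (EuclideanSpace.single i 1 : E 2) 1, 0] := by
  ext j
  fin_cases i <;> fin_cases j <;> simp

theorem enorm_integral_cylinder_pderiv_le {κ : ℝ} (hκ : 0 < κ) (ℓ : ℝ) {F : E 3 → ℂ}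
    (hF : ContDiff ℝ ∞ F) (i : Fin 2) :
    ‖∫ x in cylinder κ ℓ, pderiv i.castSucc F x‖ₑ ≤
      ∫⁻ p in Set.Ioo (0 : ℝ) (2 * Real.pi) ×ˢ Set.Ioo (0 : ℝ) ℓ,
        ‖F !₂[κ * Real.cos p.1, κ * Real.sin p.1, p.2]‖ₑ * ENNReal.ofReal κ := by
  have hab : ((EuclideanSpace.single i 1 : E 2) 0) ^ 2 + ((EuclideanSpace.single i 1 : E 2) 1) ^ 2 ≤
      (1 : ℝ) := by
    fin_cases i <;> simp
  have h := enorm_integral_cylinder_fderiv_le hκ ℓ hF hab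
  rwa [← single_castSucc_eq] at h

theorem hasDerivAt_axial {F : E 3 → ℂ} (hF : ContDiff ℝ ∞ F) (a b z : ℝ) :
    HasDerivAt (fun z => F !₂[a, b, z]) (pderiv 2 F !₂[a, b, z]) z := by
  have h1 : HasDerivAt (fun z : ℝ => (!₂[a, b, 0] : E 3) + z • (EuclideanSpace.single 2 1 : E 3))
      (EuclideanSpace.single 2 1) z := by
    simpa using ((hasDerivAt_id z).smul_const (EuclideanSpace.single 2 1 : E 3)).const_add
      (!₂[a, b, 0] : E 3)
  have he : ∀ z : ℝ, (!₂[a, b, 0] : E 3) + z • (EuclideanSpace.single 2 1 : E 3) = !₂[a, b, z] := by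
    intro z
    ext i
    fin_cases i <;> simp
  simp only [he] at h1
  exact ((hF.differentiable (by simp) _).hasFDerivAt).comp_hasDerivAt z h1

/-- The divergence theorem on the cylinder, for the axial direction and a function that takes the
same values on the two faces. -/
theorem integral_cylinder_pderiv_two (κ : ℝ) {ℓ : ℝ} (hℓ : 0 < ℓ) {F : E 3 → ℂ}
    (hF : ContDiff ℝ ∞ F) (hp : ∀ x : E 3, x 2 = 0 → F (x + EuclideanSpace.single 2 ℓ) = F x) :
    ∫ x in cylinder κ ℓ, pderiv 2 F x = 0 := by
  rw [integral_cylinder κ ℓ (integrable_cylinder_of_continuous κ ℓ (continuous_pderiv hF 2))]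
  refine (integral_congr_ae (Eventually.of_forall fun y => ?_)).trans (integral_zero _ _)
  change ∫ z in Set.Ioo 0 ℓ, pderiv 2 F !₂[y 0, y 1, z] = 0
  rw [setIntegral_Ioo_eq_sub hℓ.le (hasDerivAt_axial hF (y 0) (y 1))
    ((continuous_pderiv hF 2).comp (continuous_vec3 continuous_const continuous_const
      continuous_id)), sub_eq_zero]
  rw [← hp !₂[y 0, y 1, 0] rfl]
  congr 1
  ext i
  fin_cases i <;> simp

theorem pderiv_mul {d : ℕ} {f g : E d → ℂ} (hf : ContDiff ℝ ∞ f) (hg : ContDiff ℝ ∞ g) (i : Fin d)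
    (x : E d) : pderiv i (fun x => f x * g x) x = f x * pderiv i g x + pderiv i f x * g x := by
  unfold pderiv
  rw [fderiv_fun_mul (hf.differentiable (by simp) x) (hg.differentiable (by simp) x)]
  simp [mul_comm]

theorem contDiff_conj {d : ℕ} {f : E d → ℂ} (hf : ContDiff ℝ ∞ f) :
    ContDiff ℝ ∞ fun x => (starRingEnd ℂ) (f x) :=
  Complex.conjCLE.contDiff.comp hf

theorem pderiv_conj {d : ℕ} {f : E d → ℂ} (hf : ContDiff ℝ ∞ f) (i : Fin d) (x : E d) :
    pderiv i (fun x => (starRingEnd ℂ) (f x)) x = (starRingEnd ℂ) (pderiv i f x) := by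
  have h := (Complex.conjCLE : ℂ →L[ℝ] ℂ).hasFDerivAt.comp x
    (hf.differentiable (by simp) x).hasFDerivAt
  unfold pderiv
  have he : fderiv ℝ (fun x => (starRingEnd ℂ) (f x)) x = _ := h.fderiv
  rw [he]
  simp

theorem pderiv_coord {d : ℕ} (i : Fin d) (x : E d) :
    pderiv i (fun x : E d => (x i : ℂ)) x = 1 := by
  have h : HasFDerivAt (fun x : E d => (x i : ℂ))
      (Complex.ofRealCLM.comp (EuclideanSpace.proj (𝕜 := ℝ) i : E d →L[ℝ] ℝ)) x :=
    (Complex.ofRealCLM.comp (EuclideanSpace.proj (𝕜 := ℝ) i : E d →L[ℝ] ℝ)).hasFDerivAt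
  unfold pderiv
  rw [h.fderiv]
  simp

theorem lintegral_enorm_sq_eq_ofReal {α : Type*} [MeasurableSpace α] {μ : Measure α} {f : α → ℂ}
    (hf : Integrable (fun x => ‖f x‖ ^ 2) μ) :
    ∫⁻ x, ‖f x‖ₑ ^ 2 ∂μ = ENNReal.ofReal (∫ x, ‖f x‖ ^ 2 ∂μ) := by
  rw [ofReal_integral_eq_lintegral_ofReal hf (Eventually.of_forall fun x => by positivity)]
  refine lintegral_congr fun x => ?_
  rw [← ofReal_norm, ENNReal.ofReal_pow (norm_nonneg _)]

/-- A Poincaré inequality with a boundary term, from the divergence theorem for `x₀ |φ|²`. -/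
theorem lintegral_cylinder_le {κ : ℝ} (hκ : 0 < κ) (ℓ : ℝ) {φ : E 3 → ℂ} (hφ : ContDiff ℝ ∞ φ) :
    ∫⁻ x in cylinder κ ℓ, ‖φ x‖ₑ ^ 2 ≤
      ENNReal.ofReal (4 * κ ^ 2) * (∫⁻ x in cylinder κ ℓ, ‖pderiv 0 φ x‖ₑ ^ 2) +
      ENNReal.ofReal (2 * κ) * ∫⁻ p in Set.Ioo (0 : ℝ) (2 * Real.pi) ×ˢ Set.Ioo (0 : ℝ) ℓ,
        ‖φ !₂[κ * Real.cos p.1, κ * Real.sin p.1, p.2]‖ₑ ^ 2 * ENNReal.ofReal κ := by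
  set F : E 3 → ℂ := fun x => (x 0 : ℂ) * (φ x * (starRingEnd ℂ) (φ x)) with hFdef
  have hx0 : ContDiff ℝ ∞ fun x : E 3 => (x 0 : ℂ) :=
    Complex.ofRealCLM.contDiff.comp (contDiff_coord 0)
  have hF : ContDiff ℝ ∞ F := hx0.mul (hφ.mul (contDiff_conj hφ))
  have hFd : ∀ x, pderiv 0 F x = ((‖φ x‖ ^ 2 : ℝ) : ℂ) + (x 0 : ℂ) *
      (φ x * (starRingEnd ℂ) (pderiv 0 φ x) + pderiv 0 φ x * (starRingEnd ℂ) (φ x)) := by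
    intro x
    rw [hFdef, pderiv_mul hx0 (hφ.mul (contDiff_conj hφ)), pderiv_mul hφ (contDiff_conj hφ),
      pderiv_conj hφ, pderiv_coord, Complex.mul_conj, Complex.normSq_eq_norm_sq]
    ring
  have hφc := hφ.continuous
  have hdc := continuous_pderiv hφ 0
  have hi1 : Integrable (fun x => ‖φ x‖ ^ 2) (volume.restrict (cylinder κ ℓ)) := 
    integrable_cylinder_of_continuous κ ℓ (by fun_prop)
  have hi2 : Integrable (fun x => ‖pderiv 0 φ x‖ ^ 2) (volume.restrict (cylinder κ ℓ)) := 
    integrable_cylinder_of_continuous κ ℓ (by fun_prop)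
  have hi3 := integrable_cylinder_of_continuous κ ℓ (continuous_pderiv hF 0)
  rw [lintegral_enorm_sq_eq_ofReal hi1, lintegral_enorm_sq_eq_ofReal hi2]
  have key : ∫ x in cylinder κ ℓ, ‖φ x‖ ^ 2 ≤
      4 * κ ^ 2 * (∫ x in cylinder κ ℓ, ‖pderiv 0 φ x‖ ^ 2) +
        2 * ‖∫ x in cylinder κ ℓ, pderiv 0 F x‖ := by
    have h1 : ∀ x ∈ cylinder κ ℓ, ‖φ x‖ ^ 2 - 4 * κ ^ 2 * ‖pderiv 0 φ x‖ ^ 2 ≤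
        2 * (pderiv 0 F x).re := by
      intro x hx
      have hx1 : |x 0| ≤ κ := by
        refine abs_le_of_sq_le_sq ?_ hκ.le
        nlinarith [hx.1, sq_nonneg (x 1)]
      set u := ‖φ x‖ with hu
      set v := ‖pderiv 0 φ x‖ with hv
      have h2 : ‖(x 0 : ℂ) * (φ x * (starRingEnd ℂ) (pderiv 0 φ x) +
          pderiv 0 φ x * (starRingEnd ℂ) (φ x))‖ ≤ κ * (u * v + v * u) := by
        rw [norm_mul]
        refine mul_le_mul (by simpa using hx1) ?_ (norm_nonneg _) hκ.le
        refine (norm_add_le _ _).trans ?_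
        rw [norm_mul, norm_mul, RCLike.norm_conj, RCLike.norm_conj]
      have h3 := (abs_le.1 ((Complex.abs_re_le_norm _).trans h2)).1
      rw [hFd, Complex.add_re, Complex.ofReal_re]
      nlinarith [sq_nonneg (u - 2 * κ * v)]
    have h4 : ∫ x in cylinder κ ℓ, (‖φ x‖ ^ 2 - 4 * κ ^ 2 * ‖pderiv 0 φ x‖ ^ 2) ≤
        ∫ x in cylinder κ ℓ, 2 * (pderiv 0 F x).re :=
      setIntegral_mono_on (hi1.sub (hi2.const_mul _)) (hi3.re.const_mul 2)
        (measurableSet_cylinder κ ℓ) h1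
    rw [integral_sub hi1 (hi2.const_mul _), integral_const_mul, integral_const_mul] at h4
    have h5 : ∫ x in cylinder κ ℓ, (pderiv 0 F x).re = (∫ x in cylinder κ ℓ, pderiv 0 F x).re :=
      integral_re hi3
    have h6 := (le_abs_self _).trans (Complex.abs_re_le_norm (∫ x in cylinder κ ℓ, pderiv 0 F x))
    linarith
  have hb := enorm_integral_cylinder_pderiv_le hκ ℓ hF 0
  have hb2 : ∫⁻ p in Set.Ioo (0 : ℝ) (2 * Real.pi) ×ˢ Set.Ioo (0 : ℝ) ℓ,
        ‖F !₂[κ * Real.cos p.1, κ * Real.sin p.1, p.2]‖ₑ * ENNReal.ofReal κ ≤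
      ENNReal.ofReal κ * ∫⁻ p in Set.Ioo (0 : ℝ) (2 * Real.pi) ×ˢ Set.Ioo (0 : ℝ) ℓ,
        ‖φ !₂[κ * Real.cos p.1, κ * Real.sin p.1, p.2]‖ₑ ^ 2 * ENNReal.ofReal κ := by
    rw [← lintegral_const_mul' _ _ ENNReal.ofReal_ne_top]
    refine lintegral_mono fun p => ?_
    rw [← mul_assoc]
    gcongr
    simp only [hFdef, enorm_mul, RCLike.enorm_conj, ← sq]
    gcongr
    simp only [Matrix.cons_val_zero]
    rw [← ofReal_norm, Complex.norm_real, Real.norm_eq_abs, abs_mul, abs_of_pos hκ]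
    refine ENNReal.ofReal_le_ofReal ?_
    nlinarith [Real.abs_cos_le_one p.1]
  refine (ENNReal.ofReal_le_ofReal key).trans ?_
  rw [ENNReal.ofReal_add (by positivity) (by positivity), ENNReal.ofReal_mul (by positivity),
    ENNReal.ofReal_mul (p := 2) (by norm_num), ENNReal.ofReal_mul (p := 2) (by norm_num), mul_assoc]
  gcongr
  rw [ofReal_norm]
  exact hb.trans hb2

/-! ### Fourier coefficients in the axial variable -/

theorem eLpNorm_two_sq {α F : Type*} [MeasurableSpace α] [NormedAddCommGroup F] (f : α → F)
    (μ : Measure α) : eLpNorm f 2 μ ^ 2 = ∫⁻ x, ‖f x‖ₑ ^ 2 ∂μ := by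
  have h := eLpNorm_nnreal_pow_eq_lintegral (f := f) (μ := μ) (p := 2) (by norm_num)
  simpa using h

theorem memLp_two_iff_lintegral {α F : Type*} [MeasurableSpace α] [NormedAddCommGroup F] {f : α → F}
    {μ : Measure α} (hf : AEStronglyMeasurable f μ) :
    MemLp f 2 μ ↔ ∫⁻ x, ‖f x‖ₑ ^ 2 ∂μ < ⊤ := by
  rw [← eLpNorm_two_sq]
  constructor
  · intro h
    exact ENNReal.pow_lt_top h.2
  · intro h
    refine ⟨hf, ?_⟩
    by_contra h'
    rw [not_lt, top_le_iff] at h'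
    simp [h'] at h

theorem aestronglyMeasurable_slices {κ ℓ : ℝ} {f : E 3 → ℂ}
    (hf : AEStronglyMeasurable f (volume.restrict (cylinder κ ℓ))) :
    AEStronglyMeasurable (fun p : E 2 × ℝ => f !₂[p.1 0, p.1 1, p.2])
      ((volume.restrict (disk κ)).prod (volume.restrict (Set.Ioo 0 ℓ))) :=
  hf.comp_quasiMeasurePreserving (measurePreserving_cylEquiv_restrict κ ℓ).quasiMeasurePreserving

theorem axialCoeff_eq {ℓ : ℝ} (hℓ : 0 < ℓ) (f : E 3 → ℂ) (n : ℤ) (y : E 2) :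
    axialCoeff ℓ f n y = (ℓ : ℂ)⁻¹ * ∫ z in Set.Ioo 0 ℓ,
      f !₂[y 0, y 1, z] * Complex.exp (-(2 * Real.pi * Complex.I * n * z / ℓ)) := by
  rw [axialCoeff, intervalIntegral.integral_of_le hℓ.le, integral_Ioc_eq_integral_Ioo]

theorem aestronglyMeasurable_axialCoeff {κ ℓ : ℝ} (hℓ : 0 < ℓ) {f : E 3 → ℂ}
    (hf : AEStronglyMeasurable f (volume.restrict (cylinder κ ℓ))) (n : ℤ) :
    AEStronglyMeasurable (axialCoeff ℓ f n) (volume.restrict (disk κ)) := by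
  have h1 : AEStronglyMeasurable (fun p : E 2 × ℝ => f !₂[p.1 0, p.1 1, p.2] *
      Complex.exp (-(2 * Real.pi * Complex.I * n * p.2 / ℓ)))
      ((volume.restrict (disk κ)).prod (volume.restrict (Set.Ioo 0 ℓ))) :=
    (aestronglyMeasurable_slices hf).mul (by fun_prop)
  have h2 := (h1.integral_prod_right').const_mul (ℓ : ℂ)⁻¹
  exact h2.congr (Eventually.of_forall fun y => (axialCoeff_eq hℓ f n y).symm)

/-- Bessel's inequality on an interval. -/
theorem sum_enorm_sq_coeff_le {ℓ : ℝ} (hℓ : 0 < ℓ) {h : ℝ → ℂ}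
    (hh : AEStronglyMeasurable h (volume.restrict (Set.Ioo 0 ℓ))) (S : Finset ℤ) :
    ∑ n ∈ S, ‖(ℓ : ℂ)⁻¹ * ∫ z in Set.Ioo 0 ℓ,
      h z * Complex.exp (-(2 * Real.pi * Complex.I * n * z / ℓ))‖ₑ ^ 2 ≤
      ENNReal.ofReal ℓ⁻¹ * ∫⁻ z in Set.Ioo 0 ℓ, ‖h z‖ₑ ^ 2 := by
  by_cases hfin : ∫⁻ z in Set.Ioo 0 ℓ, ‖h z‖ₑ ^ 2 < ⊤
  swap
  · rw [not_lt, top_le_iff] at hfin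
    rw [hfin, ENNReal.mul_top]
    · exact le_top
    · simpa using hℓ
  have hL : MemLp h 2 (volume.restrict (Set.Ioc 0 ℓ)) := by
    rw [← restrict_Ioo_eq_restrict_Ioc]
    exact (memLp_two_iff_lintegral hh).2 hfin
  have hs := hasSum_sq_fourierCoeffOn hℓ hL
  have hc : ∀ n : ℤ, fourierCoeffOn hℓ h n = (ℓ : ℂ)⁻¹ * ∫ z in Set.Ioo 0 ℓ,
      h z * Complex.exp (-(2 * Real.pi * Complex.I * n * z / ℓ)) := by
    intro n
    rw [fourierCoeffOn_eq_integral, intervalIntegral.integral_of_le hℓ.le,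
      integral_Ioc_eq_integral_Ioo, Complex.real_smul]
    simp only [sub_zero, one_div, Complex.ofReal_inv]
    congr 1
    refine integral_congr_ae (Eventually.of_forall fun z => ?_)
    simp only [fourier_coe_apply, smul_eq_mul]
    rw [mul_comm]
    congr 2
    push_cast
    ring
  have hint : Integrable (fun z => ‖h z‖ ^ 2) (volume.restrict (Set.Ioo 0 ℓ)) := by
    rw [restrict_Ioo_eq_restrict_Ioc]
    exact hL.integrable_norm_pow (by norm_num)
  rw [lintegral_enorm_sq_eq_ofReal hint, ← ENNReal.ofReal_mul (by positivity)]
  have hle := sum_le_hasSum S (fun n _ => by positivity) hs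
  rw [intervalIntegral.integral_of_le hℓ.le, integral_Ioc_eq_integral_Ioo, sub_zero, smul_eq_mul]
    at hle
  refine le_trans (le_of_eq ?_) (ENNReal.ofReal_le_ofReal hle)
  rw [ENNReal.ofReal_sum_of_nonneg (fun n _ => by positivity)]
  refine Finset.sum_congr rfl fun n _ => ?_
  rw [hc, ← ofReal_norm, ENNReal.ofReal_pow (norm_nonneg _)]

theorem sum_lintegral_axialCoeff_le {κ ℓ : ℝ} (hℓ : 0 < ℓ) {f : E 3 → ℂ}
    (hf : AEStronglyMeasurable f (volume.restrict (cylinder κ ℓ))) (S : Finset ℤ) :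
    ∑ n ∈ S, ∫⁻ y in disk κ, ‖axialCoeff ℓ f n y‖ₑ ^ 2 ≤
      ENNReal.ofReal ℓ⁻¹ * ∫⁻ x in cylinder κ ℓ, ‖f x‖ₑ ^ 2 := by
  rw [lintegral_cylinder κ ℓ (hf.enorm.pow_const 2), ← lintegral_const_mul' _ _ ENNReal.ofReal_ne_top,
    ← lintegral_finsetSum' _ fun n _ =>
      ((aestronglyMeasurable_axialCoeff hℓ hf n).enorm.pow_const 2)]
  refine lintegral_mono_ae ?_
  filter_upwards [(aestronglyMeasurable_slices hf).prodMk_left] with y hy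
  simp only [axialCoeff_eq hℓ]
  exact sum_enorm_sq_coeff_le hℓ hy S

theorem memLp_axialCoeff {κ ℓ : ℝ} (hℓ : 0 < ℓ) {f : E 3 → ℂ}
    (hf : MemLp f 2 (volume.restrict (cylinder κ ℓ))) (n : ℤ) :
    MemLp (axialCoeff ℓ f n) 2 (volume.restrict (disk κ)) := by
  rw [memLp_two_iff_lintegral (aestronglyMeasurable_axialCoeff hℓ hf.1 n)]
  have h := sum_lintegral_axialCoeff_le hℓ hf.1 {n}
  rw [Finset.sum_singleton] at h
  exact h.trans_lt (ENNReal.mul_lt_top ENNReal.ofReal_lt_top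
    ((memLp_two_iff_lintegral hf.1).1 hf))

theorem summable_axialCoeff {κ ℓ : ℝ} (hℓ : 0 < ℓ) {f : E 3 → ℂ}
    (hf : MemLp f 2 (volume.restrict (cylinder κ ℓ))) :
    Summable fun n : ℤ => ∫ y in disk κ, ‖axialCoeff ℓ f n y‖ ^ 2 := by
  have hfin : ENNReal.ofReal ℓ⁻¹ * ∫⁻ x in cylinder κ ℓ, ‖f x‖ₑ ^ 2 ≠ ⊤ :=
    (ENNReal.mul_lt_top ENNReal.ofReal_lt_top ((memLp_two_iff_lintegral hf.1).1 hf)).ne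
  refine summable_of_sum_le (c := (ENNReal.ofReal ℓ⁻¹ * ∫⁻ x in cylinder κ ℓ, ‖f x‖ₑ ^ 2).toReal)
    (fun n => integral_nonneg fun y => by positivity) fun S => ?_
  rw [← ENNReal.ofReal_le_iff_le_toReal hfin, ENNReal.ofReal_sum_of_nonneg
    fun n _ => integral_nonneg fun y => by positivity]
  refine le_trans (le_of_eq ?_) (sum_lintegral_axialCoeff_le hℓ hf.1 S)
  refine Finset.sum_congr rfl fun n _ => ?_
  rw [lintegral_enorm_sq_eq_ofReal ((memLp_axialCoeff hℓ hf n).integrable_norm_pow (by norm_num))]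

/-- The function `ψ(y) exp (-2π i n z / ℓ)`. -/
def axialMode (ℓ : ℝ) (ψ : E 2 → ℂ) (n : ℤ) (x : E 3) : ℂ :=
  ψ !₂[x 0, x 1] * Complex.exp (-(2 * Real.pi * Complex.I * n * x 2 / ℓ))

theorem contDiff_vec2 {F : Type*} [NormedAddCommGroup F] [NormedSpace ℝ F] {a b : F → ℝ}
    (ha : ContDiff ℝ ∞ a) (hb : ContDiff ℝ ∞ b) :
    ContDiff ℝ ∞ fun x => (!₂[a x, b x] : E 2) := by
  refine contDiff_euclidean.2 fun i => ?_
  fin_cases i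
  · exact ha
  · exact hb

theorem contDiff_axialExp (ℓ : ℝ) (n : ℤ) : ContDiff ℝ ∞ fun x : E 3 =>
    Complex.exp (-(2 * Real.pi * Complex.I * n * x 2 / ℓ)) := by
  have h : ContDiff ℝ ∞ fun x : E 3 => (x 2 : ℂ) :=
    Complex.ofRealCLM.contDiff.comp (contDiff_coord 2)
  exact (((contDiff_const.mul h).div_const _).neg).cexp

theorem contDiff_axialMode (ℓ : ℝ) {ψ : E 2 → ℂ} (hψ : ContDiff ℝ ∞ ψ) (n : ℤ) :
    ContDiff ℝ ∞ (axialMode ℓ ψ n) :=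
  (hψ.comp (contDiff_vec2 (contDiff_coord 0) (contDiff_coord 1))).mul (contDiff_axialExp ℓ n)

theorem axialMode_add_single {ℓ : ℝ} (hℓ : 0 < ℓ) (ψ : E 2 → ℂ) (n : ℤ) (x : E 3) :
    axialMode ℓ ψ n (x + EuclideanSpace.single 2 ℓ) = axialMode ℓ ψ n x := by
  unfold axialMode
  have h0 : (ℓ : ℂ) ≠ 0 := by exact_mod_cast hℓ.ne'
  congr 1
  · simp
  · rw [Complex.exp_eq_exp_iff_exists_int]
    refine ⟨-n, ?_⟩
    simp
    field_simp
    ring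

theorem pderiv_two_eq {F : E 3 → ℂ} (hF : ContDiff ℝ ∞ F) (x : E 3) {F' : ℂ}
    (h : HasDerivAt (fun z => F !₂[x 0, x 1, z]) F' (x 2)) : pderiv 2 F x = F' := by
  have h1 := hasDerivAt_axial hF (x 0) (x 1) (x 2)
  have hx : (!₂[x 0, x 1, x 2] : E 3) = x := by
    ext i; fin_cases i <;> rfl
  rw [hx] at h1
  exact h1.unique h

theorem pderiv_two_axialMode (ℓ : ℝ) {ψ : E 2 → ℂ} (hψ : ContDiff ℝ ∞ ψ) (n : ℤ) (x : E 3) :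
    pderiv 2 (axialMode ℓ ψ n) x = -(2 * Real.pi * Complex.I * n / ℓ) * axialMode ℓ ψ n x := by
  refine pderiv_two_eq (contDiff_axialMode ℓ hψ n) x ?_
  have h1 : HasDerivAt (fun z : ℝ => -(2 * Real.pi * Complex.I * n * z / ℓ))
      (-(2 * Real.pi * Complex.I * n / ℓ)) (x 2) := by
    have h : HasDerivAt (fun z : ℝ => (z : ℂ)) 1 (x 2) := (hasDerivAt_id (x 2)).ofReal_comp
    exact (((h.const_mul (2 * Real.pi * Complex.I * n)).div_const (ℓ : ℂ)).neg).congr_deriv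
      (by ring)
  exact ((h1.cexp).const_mul (ψ !₂[x 0, x 1])).congr_deriv (by simp [axialMode]; ring)

theorem pderiv_axialMode (ℓ : ℝ) {ψ : E 2 → ℂ} (hψ : ContDiff ℝ ∞ ψ) (n : ℤ) (i : Fin 2)
    (x : E 3) : pderiv i.castSucc (axialMode ℓ ψ n) x = axialMode ℓ (pderiv i ψ) n x := by
  have h := fderiv_slice (contDiff_axialMode ℓ hψ n) !₂[x 0, x 1] (x 2)
    ((EuclideanSpace.single i 1 : E 2) 0) ((EuclideanSpace.single i 1 : E 2) 1)
  rw [← single_castSucc_eq] at h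
  have hx : (!₂[x 0, x 1, x 2] : E 3) = x := by
    ext i; fin_cases i <;> rfl
  have hv : ∀ v : E 2, (!₂[v 0, v 1] : E 2) = v := by
    intro v; ext i; fin_cases i <;> rfl
  simp only [Matrix.cons_val_zero, Matrix.cons_val_one, hx, hv] at h
  unfold pderiv
  rw [← h]
  have he : (fun y : E 2 => axialMode ℓ ψ n !₂[y 0, y 1, x 2]) = fun y =>
      ψ y * Complex.exp (-(2 * Real.pi * Complex.I * n * x 2 / ℓ)) := by
    funext y
    simp [axialMode, hv]
  rw [he, fderiv_mul_const (hψ.differentiable (by simp) _)]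
  simp [axialMode, mul_comm]

/-- Pairing with a mode is pairing of the Fourier coefficient. -/
theorem integral_mul_axialMode {κ ℓ : ℝ} (hℓ : 0 < ℓ) {f : E 3 → ℂ}
    (hf : MemLp f 2 (volume.restrict (cylinder κ ℓ))) {ψ : E 2 → ℂ} (hψ : Continuous ψ) (n : ℤ) :
    ∫ x in cylinder κ ℓ, f x * axialMode ℓ ψ n x =
      ℓ * ∫ y in disk κ, axialCoeff ℓ f n y * ψ y := by
  have hc : Continuous (axialMode ℓ ψ n) := by
    refine (hψ.comp (continuous_vec2 (by fun_prop) (by fun_prop))).mul ?_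
    exact (contDiff_axialExp ℓ n).continuous
  obtain ⟨K, hK, hsub⟩ := cylinder_subset_compact κ ℓ
  obtain ⟨C, hC⟩ := hK.exists_bound_of_continuousOn hc.continuousOn
  have hint : Integrable (fun x => f x * axialMode ℓ ψ n x) (volume.restrict (cylinder κ ℓ)) := by
    refine (hf.integrable (by norm_num)).mul_bdd (c := C) hc.aestronglyMeasurable ?_
    filter_upwards [ae_restrict_mem (measurableSet_cylinder κ ℓ)] with x hx
    exact hC x (hsub hx)
  have h0 : (ℓ : ℂ) ≠ 0 := by exact_mod_cast hℓ.ne'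
  rw [integral_cylinder κ ℓ hint, ← integral_const_mul]
  refine integral_congr_ae (Eventually.of_forall fun y => ?_)
  have hv : (!₂[y 0, y 1] : E 2) = y := by
    ext i; fin_cases i <;> rfl
  dsimp only
  rw [axialCoeff_eq hℓ, ← mul_assoc, ← mul_assoc, mul_inv_cancel₀ h0, one_mul, ← integral_mul_const]
  refine integral_congr_ae (Eventually.of_forall fun z => ?_)
  simp [axialMode, hv]
  ring

/-! ### Integration by parts without boundary terms -/

/-- `χ` takes the same values on the two faces of the cylinder of length `ℓ`. -/
def FacesMatch (ℓ : ℝ) (χ : E 3 → ℂ) : Prop :=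
  ∀ x : E 3, x 2 = 0 → χ (x + EuclideanSpace.single 2 ℓ) = χ x

/-- `g = D_i f` weakly in `Ω`, tested against all smooth functions that match on the two faces and
are unrestricted on the lateral surface. This encodes that `f` is periodic in the axial variable
and vanishes on the lateral surface. -/
def HasGreenDeriv (κ ℓ : ℝ) (i : Fin 3) (f g : E 3 → ℂ) : Prop :=
  ∀ χ : E 3 → ℂ, ContDiff ℝ ∞ χ → FacesMatch ℓ χ →
    ∫ x in cylinder κ ℓ, f x * pderiv i χ x = - ∫ x in cylinder κ ℓ, g x * χ x

theorem IsPeriodicTest.lateral_eq_zero {κ ℓ : ℝ} {φ : E 3 → ℂ} (hφ : IsPeriodicTest κ ℓ φ)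
    (θ z : ℝ) : φ !₂[κ * Real.cos θ, κ * Real.sin θ, z] = 0 := by
  obtain ⟨r, hr, h⟩ := hφ.2.2
  by_contra hne
  have h1 := h _ hne
  simp only [Matrix.cons_val_zero, Matrix.cons_val_one] at h1
  nlinarith [Real.sin_sq_add_cos_sq θ]

/-- The product of a test function with a function that matches on the faces matches on the faces and
vanishes on the lateral surface, so both parts of the divergence theorem apply. -/
theorem IsPeriodicTest.hasGreenDeriv {κ ℓ : ℝ} (hκ : 0 < κ) (hℓ : 0 < ℓ) {φ : E 3 → ℂ}
    (hφ : IsPeriodicTest κ ℓ φ) (i : Fin 3) : HasGreenDeriv κ ℓ i φ (pderiv i φ) := by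
  intro χ hχ hm
  have hF : ContDiff ℝ ∞ fun x => φ x * χ x := hφ.1.mul hχ
  have h0 : ∫ x in cylinder κ ℓ, pderiv i (fun x => φ x * χ x) x = 0 := by
    induction i using Fin.lastCases with
    | last =>
      refine integral_cylinder_pderiv_two κ hℓ hF fun x hx => ?_
      rw [hφ.2.1, hm x hx]
    | cast i =>
      have h := enorm_integral_cylinder_pderiv_le hκ ℓ hF i
      simpa [hφ.lateral_eq_zero] using h
  simp only [pderiv_mul hφ.1 hχ] at h0
  have hi1 : Integrable (fun x => φ x * pderiv i χ x) (volume.restrict (cylinder κ ℓ)) :=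
    integrable_cylinder_of_continuous κ ℓ (hφ.1.continuous.mul (continuous_pderiv hχ i))
  have hi2 : Integrable (fun x => pderiv i φ x * χ x) (volume.restrict (cylinder κ ℓ)) :=
    integrable_cylinder_of_continuous κ ℓ ((continuous_pderiv hφ.1 i).mul hχ.continuous)
  rw [integral_add hi1 hi2] at h0
  exact eq_neg_of_add_eq_zero_left h0

theorem exists_bound_cylinder (κ ℓ : ℝ) {h : E 3 → ℂ} (hh : Continuous h) :
    ∃ C : ℝ, 0 ≤ C ∧ ∀ x ∈ cylinder κ ℓ, ‖h x‖ ≤ C := by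
  obtain ⟨K, hK, hsub⟩ := cylinder_subset_compact κ ℓ
  obtain ⟨C, hC⟩ := hK.exists_bound_of_continuousOn hh.continuousOn
  exact ⟨max C 0, le_max_right _ _, fun x hx => (hC x (hsub hx)).trans (le_max_left _ _)⟩

theorem integrable_mul_continuous {κ ℓ : ℝ} {f : E 3 → ℂ}
    (hf : MemLp f 2 (volume.restrict (cylinder κ ℓ))) {h : E 3 → ℂ} (hh : Continuous h) :
    Integrable (fun x => f x * h x) (volume.restrict (cylinder κ ℓ)) := by
  obtain ⟨C, -, hC⟩ := exists_bound_cylinder κ ℓ hh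
  refine (hf.integrable (by norm_num)).mul_bdd (c := C) hh.aestronglyMeasurable ?_
  filter_upwards [ae_restrict_mem (measurableSet_cylinder κ ℓ)] with x hx
  exact hC x hx

/-- Pairing with a bounded function is continuous for convergence in quadratic mean. -/
theorem tendsto_integral_mul_of_bounded {α ι : Type*} [MeasurableSpace α] {μ : Measure α}
    [IsFiniteMeasure μ] {l : Filter ι} {f : α → ℂ} {F : ι → α → ℂ} (hf : MemLp f 2 μ)
    (hF : ∀ k, MemLp (F k) 2 μ) (hlim : Tendsto (fun k => eLpNorm (fun x => F k x - f x) 2 μ) l (𝓝 0))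
    {h : α → ℂ} (hh : AEStronglyMeasurable h μ) {C : ℝ} (hC : ∀ᵐ x ∂μ, ‖h x‖ ≤ C) :
    Tendsto (fun k => ∫ x, F k x * h x ∂μ) l (𝓝 (∫ x, f x * h x ∂μ)) := by
  refine tendsto_integral_of_L1 _ ((hf.integrable (by norm_num)).mul_bdd hh hC).1
    (Eventually.of_forall fun k => (((hF k).integrable (by norm_num)).mul_bdd hh hC)) ?_
  have h2 : ∀ k, ∫⁻ x, ‖F k x * h x - f x * h x‖ₑ ∂μ ≤
      ENNReal.ofReal C * μ Set.univ ^ (1 / 2 : ℝ) * eLpNorm (fun x => F k x - f x) 2 μ := by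
    intro k
    calc ∫⁻ x, ‖F k x * h x - f x * h x‖ₑ ∂μ
        ≤ ∫⁻ x, ENNReal.ofReal C * ‖F k x - f x‖ₑ ∂μ := by
          refine lintegral_mono_ae ?_
          filter_upwards [hC] with x hx
          rw [← sub_mul, enorm_mul, mul_comm]
          gcongr
          rw [← ofReal_norm]
          exact ENNReal.ofReal_le_ofReal hx
      _ = ENNReal.ofReal C * eLpNorm (fun x => F k x - f x) 1 μ := by
          rw [lintegral_const_mul' _ _ ENNReal.ofReal_ne_top, eLpNorm_one_eq_lintegral_enorm]
      _ ≤ ENNReal.ofReal C * (eLpNorm (fun x => F k x - f x) 2 μ * μ Set.univ ^ (1 / 2 : ℝ)) := by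
          gcongr
          have := eLpNorm_le_eLpNorm_mul_rpow_measure_univ (p := 1) (q := 2) (μ := μ) (by norm_num)
            ((hF k).1.sub hf.1)
          refine this.trans (le_of_eq ?_)
          norm_num
          rfl
      _ = _ := by ring
  refine tendsto_of_tendsto_of_tendsto_of_le_of_le tendsto_const_nhds ?_ (fun _ => zero_le) h2
  have h3 := ENNReal.Tendsto.const_mul (a := ENNReal.ofReal C * μ Set.univ ^ (1 / 2 : ℝ)) hlim
    (Or.inr (ENNReal.mul_ne_top ENNReal.ofReal_ne_top
      (ENNReal.rpow_ne_top_of_nonneg (by norm_num) (measure_ne_top _ _))))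
  simpa using h3

theorem HasGreenDeriv.of_tendsto {κ ℓ : ℝ} {i : Fin 3} {f g : E 3 → ℂ} {F G : ℕ → E 3 → ℂ}
    (hf : MemLp f 2 (volume.restrict (cylinder κ ℓ)))
    (hg : MemLp g 2 (volume.restrict (cylinder κ ℓ)))
    (hF : ∀ k, MemLp (F k) 2 (volume.restrict (cylinder κ ℓ)))
    (hG : ∀ k, MemLp (G k) 2 (volume.restrict (cylinder κ ℓ)))
    (hFlim : Tendsto (fun k => eLpNorm (fun x => F k x - f x) 2 (volume.restrict (cylinder κ ℓ)))
      atTop (𝓝 0))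
    (hGlim : Tendsto (fun k => eLpNorm (fun x => G k x - g x) 2 (volume.restrict (cylinder κ ℓ)))
      atTop (𝓝 0))
    (h : ∀ k, HasGreenDeriv κ ℓ i (F k) (G k)) : HasGreenDeriv κ ℓ i f g := by
  intro χ hχ hm
  have hae : ∀ {C : ℝ} {k : E 3 → ℂ}, (∀ x ∈ cylinder κ ℓ, ‖k x‖ ≤ C) →
      ∀ᵐ x ∂(volume.restrict (cylinder κ ℓ)), ‖k x‖ ≤ C := fun hC =>
    (ae_restrict_mem (measurableSet_cylinder κ ℓ)).mono hC
  obtain ⟨C, -, hC⟩ := exists_bound_cylinder κ ℓ (continuous_pderiv hχ i)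
  obtain ⟨C', -, hC'⟩ := exists_bound_cylinder κ ℓ hχ.continuous
  have h1 := tendsto_integral_mul_of_bounded hf hF hFlim
    (continuous_pderiv hχ i).aestronglyMeasurable (hae hC)
  have h2 := (tendsto_integral_mul_of_bounded hg hG hGlim
    hχ.continuous.aestronglyMeasurable (hae hC')).neg
  refine tendsto_nhds_unique h1 (h2.congr fun k => ?_)
  exact (h k χ hχ hm).symm

theorem HasGreenDeriv.hasWeakDeriv {κ ℓ : ℝ} {i : Fin 3} {f g : E 3 → ℂ}
    (h : HasGreenDeriv κ ℓ i f g) : HasWeakDeriv (cylinder κ ℓ) i f g := by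
  intro φ hφ _ hsupp
  have h0 : ∀ x, x ∉ cylinder κ ℓ → φ x = 0 := fun x hx =>
    image_eq_zero_of_notMem_tsupport fun h => hx (hsupp h)
  refine h φ hφ fun x hx => ?_
  rw [h0 x fun h => h.2.1.ne' hx, h0]
  intro h
  have := h.2.2
  simp [hx] at this

/-- Uniqueness of a locally integrable function with given pairings against test functions. -/
theorem ae_eq_of_integral_test_eq {d : ℕ} {U : Set (E d)} (hU : IsOpen U) {f g : E d → ℂ}
    (hf : IntegrableOn f U) (hg : IntegrableOn g U)
    (h : ∀ φ : E d → ℂ, ContDiff ℝ ∞ φ → HasCompactSupport φ → tsupport φ ⊆ U →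
      ∫ x in U, f x * φ x = ∫ x in U, g x * φ x) : f =ᵐ[volume.restrict U] g := by
  have key := hU.ae_eq_zero_of_integral_contDiff_smul_eq_zero (μ := volume) (f := fun x => f x - g x)
    (hf.sub hg).locallyIntegrableOn ?_
  · rw [EventuallyEq, ae_restrict_iff' hU.measurableSet]
    filter_upwards [key] with x hx hxU
    exact sub_eq_zero.1 (hx hxU)
  · intro φ hφ hc hs
    have hts : tsupport (fun x => (φ x : ℂ)) ⊆ tsupport φ := by
      refine closure_mono fun x hx hx' => hx ?_
      simp [hx']
    have h1 := h (fun x => (φ x : ℂ)) (Complex.ofRealCLM.contDiff.comp hφ)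
      (hc.comp_left (g := fun t : ℝ => (t : ℂ)) (by simp)) (hts.trans hs)
    obtain ⟨C, hC⟩ := hc.exists_bound_of_continuous hφ.continuous
    have hi : ∀ {k : E d → ℂ}, IntegrableOn k U → IntegrableOn (fun x => k x * (φ x : ℂ)) U :=
      fun hk => hk.mul_bdd (c := C)
        (Complex.continuous_ofReal.comp hφ.continuous).aestronglyMeasurable
        (Eventually.of_forall fun x => by simpa using hC x)
    rw [← setIntegral_eq_integral_of_forall_compl_eq_zero (s := U)]
    · have h2 : ∫ x in U, φ x • (f x - g x) = ∫ x in U, (f x * φ x - g x * φ x) := by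
        refine integral_congr_ae (Eventually.of_forall fun x => ?_)
        simp only [Complex.real_smul]
        ring
      rw [h2, integral_sub (hi hf) (hi hg), h1, sub_self]
    · intro x hx
      rw [image_eq_zero_of_notMem_tsupport fun h => hx (hs h), zero_smul]

theorem HasWeakDeriv.ae_eq {d : ℕ} {U : Set (E d)} (hU : IsOpen U) {i : Fin d} {f g g' : E d → ℂ}
    (hg : IntegrableOn g U) (hg' : IntegrableOn g' U) (h : HasWeakDeriv U i f g)
    (h' : HasWeakDeriv U i f g') : g =ᵐ[volume.restrict U] g' :=
  ae_eq_of_integral_test_eq hU hg hg' fun φ hφ hc hs =>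
    neg_injective ((h φ hφ hc hs).symm.trans (h' φ hφ hc hs))

theorem facesMatch_axialMode {ℓ : ℝ} (hℓ : 0 < ℓ) (ψ : E 2 → ℂ) (n : ℤ) :
    FacesMatch ℓ (axialMode ℓ ψ n) := fun x _ => axialMode_add_single hℓ ψ n x

/-- Testing with the modes `ψ(y) exp (-2π i n z / ℓ)` differentiates the Fourier coefficients. -/
theorem HasGreenDeriv.axialCoeff {κ ℓ : ℝ} (hℓ : 0 < ℓ) {i : Fin 2} {f g : E 3 → ℂ}
    (hf : MemLp f 2 (volume.restrict (cylinder κ ℓ)))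
    (hg : MemLp g 2 (volume.restrict (cylinder κ ℓ)))
    (h : HasGreenDeriv κ ℓ i.castSucc f g) (n : ℤ) :
    HasWeakDeriv (disk κ) i (axialCoeff ℓ f n) (axialCoeff ℓ g n) := by
  intro ψ hψ _ _
  have h1 := h _ (contDiff_axialMode ℓ hψ n) (facesMatch_axialMode hℓ ψ n)
  simp only [pderiv_axialMode ℓ hψ] at h1
  rw [integral_mul_axialMode hℓ hf (continuous_pderiv hψ i),
    integral_mul_axialMode hℓ hg hψ.continuous, ← mul_neg] at h1
  exact mul_left_cancel₀ (by exact_mod_cast hℓ.ne') h1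

/-- Integration by parts in the axial variable: `ĝ_n = (2π i n / ℓ) f̂_n`. -/
theorem HasGreenDeriv.axialCoeff_two {κ ℓ : ℝ} (hℓ : 0 < ℓ) {f g : E 3 → ℂ}
    (hf : MemLp f 2 (volume.restrict (cylinder κ ℓ)))
    (hg : MemLp g 2 (volume.restrict (cylinder κ ℓ)))
    (h : HasGreenDeriv κ ℓ 2 f g) (n : ℤ) :
    Jet.axialCoeff ℓ g n =ᵐ[volume.restrict (disk κ)]
      fun y => 2 * Real.pi * Complex.I * n / ℓ * Jet.axialCoeff ℓ f n y := by
  have hl : (ℓ : ℂ) ≠ 0 := by exact_mod_cast hℓ.ne'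
  refine ae_eq_of_integral_test_eq (isOpen_disk κ) ((memLp_axialCoeff hℓ hg n).integrable
    (by norm_num)) (((memLp_axialCoeff hℓ hf n).integrable (by norm_num)).const_mul _) ?_
  intro ψ hψ _ _
  have h1 := h _ (contDiff_axialMode ℓ hψ n) (facesMatch_axialMode hℓ ψ n)
  simp only [pderiv_two_axialMode ℓ hψ] at h1
  have h2 : ∫ x in cylinder κ ℓ, f x * (-(2 * Real.pi * Complex.I * n / ℓ) * axialMode ℓ ψ n x) =
      -(2 * Real.pi * Complex.I * n / ℓ) * ∫ x in cylinder κ ℓ, f x * axialMode ℓ ψ n x := by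
    rw [← integral_const_mul]
    refine integral_congr_ae (Eventually.of_forall fun x => ?_)
    dsimp only
    ring
  rw [h2, integral_mul_axialMode hℓ hf hψ.continuous,
    integral_mul_axialMode hℓ hg hψ.continuous, neg_mul, neg_inj, mul_left_comm] at h1
  simp only [mul_assoc, integral_const_mul] at h1 ⊢
  exact (mul_left_cancel₀ hl h1).symm

/-- A function with square integrable gradient in the sense of `HasGreenDeriv` is in `H¹_p`: the
weighted norms of its Fourier coefficients are norms of Fourier coefficients of the gradient. -/
theorem mem_H1p_of_hasGreenDeriv {κ ℓ : ℝ} (hℓ : 0 < ℓ) {q : L2 κ ℓ}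
    {w : Fin 3 → E 3 → ℂ} (hw : ∀ i, MemLp (w i) 2 (volume.restrict (cylinder κ ℓ)))
    (h : ∀ i, HasGreenDeriv κ ℓ i q (w i)) : q ∈ H1p κ ℓ := by
  have hq : MemLp q 2 (volume.restrict (cylinder κ ℓ)) := Lp.memLp q
  refine ⟨⟨w, hq, fun i => ⟨hw i, (h i).hasWeakDeriv⟩⟩,
    fun n i => axialCoeff ℓ (w i.castSucc) n, fun n => ⟨memLp_axialCoeff hℓ hq n, fun i =>
      ⟨memLp_axialCoeff hℓ (hw _) n, (h _).axialCoeff hℓ hq (hw _) n⟩⟩, ?_⟩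
  have h2 : ∀ n : ℤ, (2 * Real.pi * n) ^ 2 / ℓ * ∫ y in disk κ, ‖axialCoeff ℓ q n y‖ ^ 2 =
      ℓ * ∫ y in disk κ, ‖axialCoeff ℓ (w 2) n y‖ ^ 2 := by
    intro n
    rw [← integral_const_mul, ← integral_const_mul]
    refine integral_congr_ae ?_
    filter_upwards [(h 2).axialCoeff_two hℓ hq (hw 2) n] with y hy
    rw [hy, norm_mul]
    have : ‖2 * Real.pi * Complex.I * n / ℓ‖ = |2 * Real.pi * n| / ℓ := by
      simp [abs_mul, abs_of_pos hℓ]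
    rw [this, mul_pow (|_| / _), div_pow, sq_abs]
    field_simp
  simp only [h2]
  refine Summable.add (Summable.mul_left _ (Summable.add (summable_axialCoeff hℓ hq) ?_))
    ((summable_axialCoeff hℓ (hw 2)).mul_left _)
  exact summable_sum fun i _ => summable_axialCoeff hℓ (hw _)

/-! ### Gradients of test functions and their closure -/

theorem tendsto_zero_of_sq {ι : Type*} {l : Filter ι} {f : ι → ENNReal}
    (h : Tendsto (fun k => f k ^ 2) l (𝓝 0)) : Tendsto f l (𝓝 0) := by
  have h3 := h.ennrpow_const (1 / 2 : ℝ)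
  norm_num at h3
  refine h3.congr fun k => ?_
  rw [← ENNReal.rpow_natCast, ← ENNReal.rpow_mul]
  norm_num

theorem pderiv_add {d : ℕ} {f g : E d → ℂ} (hf : ContDiff ℝ ∞ f) (hg : ContDiff ℝ ∞ g) (i : Fin d)
    (x : E d) : pderiv i (fun x => f x + g x) x = pderiv i f x + pderiv i g x := by
  unfold pderiv
  rw [fderiv_fun_add (hf.differentiable (by simp) x) (hg.differentiable (by simp) x)]
  simp

theorem pderiv_sub {d : ℕ} {f g : E d → ℂ} (hf : ContDiff ℝ ∞ f) (hg : ContDiff ℝ ∞ g) (i : Fin d)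
    (x : E d) : pderiv i (fun x => f x - g x) x = pderiv i f x - pderiv i g x := by
  unfold pderiv
  rw [fderiv_fun_sub (hf.differentiable (by simp) x) (hg.differentiable (by simp) x)]
  simp

theorem pderiv_const_mul {d : ℕ} {f : E d → ℂ} (hf : ContDiff ℝ ∞ f) (c : ℂ) (i : Fin d)
    (x : E d) : pderiv i (fun x => c * f x) x = c * pderiv i f x := by
  unfold pderiv
  rw [fderiv_const_mul (hf.differentiable (by simp) x)]
  simp

theorem IsPeriodicTest.add {κ ℓ : ℝ} {φ ψ : E 3 → ℂ} (hφ : IsPeriodicTest κ ℓ φ)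
    (hψ : IsPeriodicTest κ ℓ ψ) : IsPeriodicTest κ ℓ fun x => φ x + ψ x := by
  obtain ⟨r, hr, h⟩ := hφ.2.2
  obtain ⟨s, hs, h'⟩ := hψ.2.2
  refine ⟨hφ.1.add hψ.1, fun x => by simp only [hφ.2.1, hψ.2.1], max r s, max_lt hr hs, fun x hx => ?_⟩
  by_cases h0 : φ x = 0
  · exact (h' x fun h1 => hx (by simp [h0, h1])).trans (le_max_right _ _)
  · exact (h x h0).trans (le_max_left _ _)

theorem IsPeriodicTest.const_mul {κ ℓ : ℝ} {φ : E 3 → ℂ} (hφ : IsPeriodicTest κ ℓ φ) (c : ℂ) :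
    IsPeriodicTest κ ℓ fun x => c * φ x := by
  obtain ⟨r, hr, h⟩ := hφ.2.2
  exact ⟨contDiff_const.mul hφ.1, fun x => by simp only [hφ.2.1], r, hr, fun x hx =>
    h x (right_ne_zero_of_mul hx)⟩

theorem IsPeriodicTest.conj {κ ℓ : ℝ} {φ : E 3 → ℂ} (hφ : IsPeriodicTest κ ℓ φ) :
    IsPeriodicTest κ ℓ fun x => (starRingEnd ℂ) (φ x) := by
  obtain ⟨r, hr, h⟩ := hφ.2.2
  exact ⟨contDiff_conj hφ.1, fun x => by simp only [hφ.2.1], r, hr, fun x hx =>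
    h x fun h0 => hx (by simp [h0])⟩

theorem isPeriodicTest_zero {κ : ℝ} (hκ : 0 < κ) (ℓ : ℝ) : IsPeriodicTest κ ℓ fun _ => 0 :=
  ⟨contDiff_const, fun _ => rfl, 0, by positivity, fun _ h => absurd rfl h⟩

/-- The gradients of the periodic test functions, as a subspace of `L²(Ω)³`. -/
def testGradients {κ : ℝ} (hκ : 0 < κ) (ℓ : ℝ) : Submodule ℂ (L2Vec κ ℓ) where
  carrier := {w | ∃ φ, IsPeriodicTest κ ℓ φ ∧
    ∀ᵐ x ∂(volume.restrict (cylinder κ ℓ)), ∀ i, w x i = pderiv i φ x}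
  zero_mem' := by
    refine ⟨_, isPeriodicTest_zero hκ ℓ, ?_⟩
    filter_upwards [Lp.coeFn_zero (EuclideanSpace ℂ (Fin 3)) 2
      (volume.restrict (cylinder κ ℓ))] with x hx i
    rw [hx]
    simp [pderiv]
  add_mem' := by
    rintro u v ⟨φ, hφ, h⟩ ⟨ψ, hψ, h'⟩
    refine ⟨_, hφ.add hψ, ?_⟩
    filter_upwards [Lp.coeFn_add u v, h, h'] with x hx h1 h2 i
    rw [hx, pderiv_add hφ.1 hψ.1, ← h1, ← h2]
    rfl
  smul_mem' := by
    rintro c u ⟨φ, hφ, h⟩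
    refine ⟨_, hφ.const_mul c, ?_⟩
    filter_upwards [Lp.coeFn_smul c u, h] with x hx h1 i
    rw [hx, pderiv_const_mul hφ.1, ← h1]
    rfl

/-- The field in `L²(Ω)³` with the given square integrable components. -/
theorem exists_L2Vec {κ ℓ : ℝ} {g : Fin 3 → E 3 → ℂ}
    (hg : ∀ i, MemLp (g i) 2 (volume.restrict (cylinder κ ℓ))) :
    ∃ w : L2Vec κ ℓ, ∀ᵐ x ∂(volume.restrict (cylinder κ ℓ)), ∀ i, w x i = g i x := by
  have h : MemLp (fun x => (WithLp.toLp 2 fun i => g i x : EuclideanSpace ℂ (Fin 3))) 2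
      (volume.restrict (cylinder κ ℓ)) := by
    have h1 : ∀ i : Fin 3, MemLp (fun x => (EuclideanSpace.single i (g i x) :
        EuclideanSpace ℂ (Fin 3))) 2 (volume.restrict (cylinder κ ℓ)) := fun i =>
      (((PiLp.continuousLinearEquiv 2 ℂ (fun _ : Fin 3 => ℂ)).symm :
        (Fin 3 → ℂ) →L[ℂ] EuclideanSpace ℂ (Fin 3)).comp
        (ContinuousLinearMap.single ℂ (fun _ : Fin 3 => ℂ) i)).comp_memLp' (hg i)
    have h2 := (h1 0).add ((h1 1).add (h1 2))
    convert h2 using 1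
    funext x
    ext i
    fin_cases i <;> simp
  refine ⟨h.toLp _, ?_⟩
  filter_upwards [h.coeFn_toLp] with x hx i
  rw [hx]

theorem memLp_cylinder_of_continuous {κ ℓ : ℝ} {f : E 3 → ℂ} (hf : Continuous f) :
    MemLp f 2 (volume.restrict (cylinder κ ℓ)) := by
  obtain ⟨C, -, hC⟩ := exists_bound_cylinder κ ℓ hf
  exact MemLp.of_bound hf.aestronglyMeasurable C
    ((ae_restrict_mem (measurableSet_cylinder κ ℓ)).mono hC)

theorem memLp_component {κ ℓ : ℝ} (w : L2Vec κ ℓ) (i : Fin 3) :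
    MemLp (fun x => w x i) 2 (volume.restrict (cylinder κ ℓ)) :=
  (EuclideanSpace.proj (𝕜 := ℂ) i : EuclideanSpace ℂ (Fin 3) →L[ℂ] ℂ).comp_memLp' (Lp.memLp w)

theorem inner_eq_integral {κ ℓ : ℝ} (u v : L2Vec κ ℓ) {φ : E 3 → ℂ} (hφ : ContDiff ℝ ∞ φ)
    (hv : ∀ᵐ x ∂(volume.restrict (cylinder κ ℓ)), ∀ i, v x i = pderiv i φ x) :
    inner ℂ v u = ∫ x in cylinder κ ℓ,
      ∑ i, u x i * pderiv i (fun x => (starRingEnd ℂ) (φ x)) x := by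
  rw [MeasureTheory.L2.inner_def]
  refine integral_congr_ae ?_
  filter_upwards [hv] with x hx
  simp only [PiLp.inner_apply, RCLike.inner_apply, pderiv_conj hφ, hx]

/-- The inner product with `∇φ` is the pairing with the gradient of the conjugate test function. -/
theorem P0_eq_orthogonal {κ : ℝ} (hκ : 0 < κ) (ℓ : ℝ) : P0 κ ℓ = (testGradients hκ ℓ)ᗮ := by
  ext u
  rw [Submodule.mem_orthogonal]
  constructor
  · rintro hu v ⟨φ, hφ, hv⟩
    rw [inner_eq_integral u v hφ.1 hv]
    exact hu _ hφ.conj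
  · intro h φ hφ
    obtain ⟨v, hv⟩ := exists_L2Vec (κ := κ) (ℓ := ℓ) fun i =>
      memLp_cylinder_of_continuous (continuous_pderiv hφ.conj.1 i)
    have h1 := h v ⟨_, hφ.conj, hv⟩
    rw [inner_eq_integral u v hφ.conj.1 hv] at h1
    simpa using h1

theorem P0_orthogonal {κ : ℝ} (hκ : 0 < κ) (ℓ : ℝ) :
    (P0 κ ℓ)ᗮ = (testGradients hκ ℓ).topologicalClosure := by
  rw [P0_eq_orthogonal hκ, Submodule.orthogonal_orthogonal_eq_closure]

/-- Poincaré's inequality for functions vanishing on the lateral surface. -/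
theorem eLpNorm_le_of_lateral_eq_zero {κ : ℝ} (hκ : 0 < κ) (ℓ : ℝ) {φ : E 3 → ℂ}
    (hφ : ContDiff ℝ ∞ φ)
    (h0 : ∀ θ z, φ !₂[κ * Real.cos θ, κ * Real.sin θ, z] = 0) :
    eLpNorm φ 2 (volume.restrict (cylinder κ ℓ)) ≤
      ENNReal.ofReal (2 * κ) * eLpNorm (pderiv 0 φ) 2 (volume.restrict (cylinder κ ℓ)) := by
  have h := lintegral_cylinder_le hκ ℓ hφ
  simp only [h0, enorm_zero, ne_eq, OfNat.ofNat_ne_zero, not_false_eq_true, zero_pow, zero_mul,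
    lintegral_zero, mul_zero, add_zero] at h
  rw [← eLpNorm_two_sq, ← eLpNorm_two_sq, show 4 * κ ^ 2 = (2 * κ) ^ 2 by ring,
    ENNReal.ofReal_pow (by positivity), ← mul_pow] at h
  exact (ENNReal.pow_le_pow_left_iff two_ne_zero).1 h

theorem eLpNorm_component_sub_le {κ ℓ : ℝ} (u v : L2Vec κ ℓ) (i : Fin 3) :
    eLpNorm (fun x => u x i - v x i) 2 (volume.restrict (cylinder κ ℓ)) ≤ edist u v := by
  rw [Lp.edist_def]
  refine eLpNorm_mono fun x => ?_
  exact PiLp.norm_apply_le (u x - v x) i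

/-- Limits of gradients of test functions are gradients: by Poincaré's inequality the test
functions converge as well. -/
theorem exists_of_mem_closure {κ ℓ : ℝ} (hκ : 0 < κ) (hℓ : 0 < ℓ) {w : L2Vec κ ℓ}
    (hw : w ∈ (testGradients hκ ℓ).topologicalClosure) :
    ∃ q ∈ H1pZero κ ℓ, IsGradient q w := by
  obtain ⟨v, hv, hlim⟩ := mem_closure_iff_seq_limit.1
    (show w ∈ closure (testGradients hκ ℓ : Set (L2Vec κ ℓ)) from hw)
  choose φ hφ hgrad using hv
  have hmem : ∀ k, MemLp (φ k) 2 (volume.restrict (cylinder κ ℓ)) := fun k =>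
    memLp_cylinder_of_continuous (hφ k).1.continuous
  have hle : ∀ k m, edist ((hmem k).toLp (φ k)) ((hmem m).toLp (φ m)) ≤
      ENNReal.ofReal (2 * κ) * edist (v k) (v m) := by
    intro k m
    rw [Lp.edist_toLp_toLp]
    refine (eLpNorm_le_of_lateral_eq_zero hκ ℓ (φ := φ k - φ m) ((hφ k).1.sub (hφ m).1)
      fun θ z => by simp [(hφ _).lateral_eq_zero]).trans ?_
    gcongr
    refine le_trans (le_of_eq (eLpNorm_congr_ae ?_)) (eLpNorm_component_sub_le (v k) (v m) 0)
    filter_upwards [hgrad k, hgrad m] with x h1 h2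
    rw [h1, h2]
    exact pderiv_sub (hφ k).1 (hφ m).1 0 x
  have hcau : CauchySeq fun k => (hmem k).toLp (φ k) := by
    have hlip : ∀ k m, dist ((hmem k).toLp (φ k)) ((hmem m).toLp (φ m)) ≤
        2 * κ * dist (v k) (v m) := by
      intro k m
      rw [dist_edist, dist_edist, ← ENNReal.toReal_ofReal (show 0 ≤ 2 * κ by positivity),
        ← ENNReal.toReal_mul]
      exact ENNReal.toReal_mono (ENNReal.mul_ne_top ENNReal.ofReal_ne_top (edist_ne_top _ _))
        (hle k m)
    rw [Metric.cauchySeq_iff]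
    intro ε hε
    obtain ⟨N, hN⟩ := Metric.cauchySeq_iff.1 hlim.cauchySeq (ε / (2 * κ)) (by positivity)
    refine ⟨N, fun m hm n hn => (hlip m n).trans_lt ?_⟩
    have := hN m hm n hn
    rwa [lt_div_iff₀ (by positivity), mul_comm] at this
  obtain ⟨q, hq⟩ := cauchySeq_tendsto_of_complete hcau
  have hqlim : Tendsto (fun k => eLpNorm (fun x => φ k x - q x) 2
      (volume.restrict (cylinder κ ℓ))) atTop (𝓝 0) := by
    have h1 := (tendsto_iff_edist_tendsto_0.1 hq)
    refine h1.congr fun k => ?_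
    rw [Lp.edist_def]
    refine eLpNorm_congr_ae ?_
    filter_upwards [(hmem k).coeFn_toLp] with x hx
    simp [hx]
  have hwlim : ∀ i, Tendsto (fun k => eLpNorm (fun x => pderiv i (φ k) x - w x i) 2
      (volume.restrict (cylinder κ ℓ))) atTop (𝓝 0) := by
    intro i
    refine tendsto_of_tendsto_of_tendsto_of_le_of_le tendsto_const_nhds
      (tendsto_iff_edist_tendsto_0.1 hlim) (fun _ => zero_le) fun k => ?_
    refine le_trans (le_of_eq (eLpNorm_congr_ae ?_)) (eLpNorm_component_sub_le (v k) w i)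
    filter_upwards [hgrad k] with x hx
    rw [hx]
  have hgreen : ∀ i, HasGreenDeriv κ ℓ i q fun x => w x i := fun i =>
    HasGreenDeriv.of_tendsto (Lp.memLp q) (memLp_component w i) hmem
      (fun k => memLp_cylinder_of_continuous (continuous_pderiv (hφ k).1 i)) hqlim (hwlim i)
      fun k => (hφ k).hasGreenDeriv hκ hℓ i
  refine ⟨q, ⟨mem_H1p_of_hasGreenDeriv hℓ (memLp_component w) hgreen, ?_⟩, fun i =>
    (hgreen i).hasWeakDeriv⟩
  refine ⟨fun i x => w x i, ⟨Lp.memLp q, fun i => ⟨memLp_component w i, (hgreen i).hasWeakDeriv⟩⟩,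
    φ, fun k => (hφ k).1, hqlim, hwlim, ?_⟩
  simp [(hφ _).lateral_eq_zero]

/-- A function in `⁰H¹_p` is determined by its gradient, again by Poincaré's inequality. -/
theorem eq_of_isGradient {κ ℓ : ℝ} (hκ : 0 < κ) {q q' : L2 κ ℓ} (hq : q ∈ H1pZero κ ℓ)
    (hq' : q' ∈ H1pZero κ ℓ) {w : L2Vec κ ℓ} (h : IsGradient q w) (h' : IsGradient q' w) :
    q = q' := by
  obtain ⟨-, G, hG, φ, hφ, hφlim, hGlim, htr⟩ := hq
  obtain ⟨-, G', hG', φ', hφ', hφlim', hGlim', htr'⟩ := hq'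
  set μ := volume.restrict (cylinder κ ℓ) with hμ
  have hGG : G 0 =ᵐ[μ] G' 0 := by
    have hi : ∀ {g : E 3 → ℂ}, MemLp g 2 μ → IntegrableOn g (cylinder κ ℓ) := fun hg =>
      hg.integrable (by norm_num)
    exact ((hG.2 0).2.ae_eq (isOpen_cylinder κ ℓ) (hi (hG.2 0).1) (hi (memLp_component w 0))
      (h 0)).trans ((hG'.2 0).2.ae_eq (isOpen_cylinder κ ℓ) (hi (hG'.2 0).1)
      (hi (memLp_component w 0)) (h' 0)).symm
  have hsq : ∀ {α : Type} [MeasurableSpace α] {ν : Measure α} {f g : α → ℂ},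
      AEMeasurable f ν → ∫⁻ x, ‖f x - g x‖ₑ ^ 2 ∂ν ≤
        2 * (∫⁻ x, ‖f x‖ₑ ^ 2 ∂ν) + 2 * ∫⁻ x, ‖g x‖ₑ ^ 2 ∂ν := by
    intro α _ ν f g hf
    rw [← lintegral_const_mul' _ _ (by norm_num), ← lintegral_const_mul' _ _ (by norm_num),
      ← lintegral_add_left' ((hf.enorm.pow_const 2).const_mul 2)]
    refine lintegral_mono fun x => ?_
    have h1 : ‖f x - g x‖ₑ ≤ ‖f x‖ₑ + ‖g x‖ₑ := enorm_sub_le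
    refine (pow_le_pow_left₀ zero_le h1 2).trans ?_
    simp only [enorm_eq_nnnorm]
    norm_cast
    exact add_sq_le.trans (le_of_eq (by ring))
  -- the differences of the smooth approximations tend to zero in quadratic mean
  have hdiff : Tendsto (fun k => eLpNorm (fun x => φ k x - φ' k x) 2 μ) atTop (𝓝 0) := by
    have hb : ∀ k, eLpNorm (fun x => φ k x - φ' k x) 2 μ ^ 2 ≤
        ENNReal.ofReal (4 * κ ^ 2) * (eLpNorm (fun x => pderiv 0 (φ k) x - G 0 x) 2 μ +
          eLpNorm (fun x => pderiv 0 (φ' k) x - G' 0 x) 2 μ) ^ 2 +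
        ENNReal.ofReal (2 * κ) * (2 * (∫⁻ p in Set.Ioo (0 : ℝ) (2 * Real.pi) ×ˢ Set.Ioo (0 : ℝ) ℓ,
          ‖φ k !₂[κ * Real.cos p.1, κ * Real.sin p.1, p.2] - 0‖ₑ ^ 2 * ENNReal.ofReal κ) +
          2 * ∫⁻ p in Set.Ioo (0 : ℝ) (2 * Real.pi) ×ˢ Set.Ioo (0 : ℝ) ℓ,
          ‖φ' k !₂[κ * Real.cos p.1, κ * Real.sin p.1, p.2] - 0‖ₑ ^ 2 * ENNReal.ofReal κ) := by
      intro k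
      rw [eLpNorm_two_sq]
      refine (lintegral_cylinder_le hκ ℓ ((hφ k).sub (hφ' k))).trans ?_
      rw [← eLpNorm_two_sq]
      refine add_le_add ?_ (mul_le_mul' le_rfl ?_)
      · gcongr
        refine le_trans (le_of_eq (eLpNorm_congr_ae ?_)) (eLpNorm_sub_le (p := 2)
          ((continuous_pderiv (hφ k) 0).aestronglyMeasurable.sub (hG.2 0).1.1)
          ((continuous_pderiv (hφ' k) 0).aestronglyMeasurable.sub (hG'.2 0).1.1) (by norm_num))
        filter_upwards [hGG] with x hx
        have := pderiv_sub (hφ k) (hφ' k) 0 x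
        simp only [Pi.sub_apply, hx]
        rw [this]
        ring
      · simp only [sub_zero]
        rw [lintegral_mul_const' _ _ ENNReal.ofReal_ne_top,
          lintegral_mul_const' _ _ ENNReal.ofReal_ne_top,
          lintegral_mul_const' _ _ ENNReal.ofReal_ne_top, ← mul_assoc, ← mul_assoc, ← add_mul]
        gcongr
        refine hsq ?_
        exact ((hφ k).continuous.comp (continuous_vec3 (by fun_prop) (by fun_prop)
          (by fun_prop))).measurable.aemeasurable
    have h0 : Tendsto (fun k => eLpNorm (fun x => φ k x - φ' k x) 2 μ ^ 2) atTop (𝓝 0) := by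
      refine tendsto_of_tendsto_of_tendsto_of_le_of_le tendsto_const_nhds ?_ (fun _ => zero_le) hb
      have h1 := ENNReal.Tendsto.const_mul (a := ENNReal.ofReal (4 * κ ^ 2))
        (ENNReal.Tendsto.pow (n := 2) ((hGlim 0).add (hGlim' 0))) (Or.inr ENNReal.ofReal_ne_top)
      have h2 := ENNReal.Tendsto.const_mul (a := ENNReal.ofReal (2 * κ))
        ((ENNReal.Tendsto.const_mul (a := 2) htr (Or.inr (by norm_num))).add
          (ENNReal.Tendsto.const_mul (a := 2) htr' (Or.inr (by norm_num))))
        (Or.inr ENNReal.ofReal_ne_top)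
      simpa using h1.add h2
    exact tendsto_zero_of_sq h0
  have hedist : edist q q' ≤ 0 := by
    refine ge_of_tendsto' (f := fun k => eLpNorm (fun x => φ k x - q x) 2 μ +
      eLpNorm (fun x => φ k x - φ' k x) 2 μ + eLpNorm (fun x => φ' k x - q' x) 2 μ)
      (by simpa using (hφlim.add hdiff).add hφlim') fun k => ?_
    have hm : ∀ {ψ : E 3 → ℂ}, ContDiff ℝ ∞ ψ → AEStronglyMeasurable ψ μ := fun hψ =>
      hψ.continuous.aestronglyMeasurable
    have m1 := (hm (hφ k)).sub (Lp.memLp q).1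
    have m2 := (hm (hφ k)).sub (hm (hφ' k))
    have m3 := (hm (hφ' k)).sub (Lp.memLp q').1
    rw [Lp.edist_def, ← eLpNorm_neg, show -(⇑q - ⇑q') = ((φ k - ⇑q) - (φ k - φ' k)) - (φ' k - ⇑q') by
      ring]
    refine (eLpNorm_sub_le (m1.sub m2) m3 (by norm_num)).trans ?_
    gcongr ?_ + ?_
    · exact eLpNorm_sub_le m1 m2 (by norm_num)
    · exact le_rfl
  exact edist_le_zero.1 hedist

/-! ### Functions in `⁰H¹_p` integrate by parts without boundary terms -/

theorem tendsto_lintegral_enorm_of_sq {α ι : Type*} [MeasurableSpace α] {ν : Measure α}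
    [IsFiniteMeasure ν] {l : Filter ι} {f : ι → α → ℂ} (hf : ∀ k, AEStronglyMeasurable (f k) ν)
    (h : Tendsto (fun k => ∫⁻ x, ‖f k x‖ₑ ^ 2 ∂ν) l (𝓝 0)) :
    Tendsto (fun k => ∫⁻ x, ‖f k x‖ₑ ∂ν) l (𝓝 0) := by
  simp only [← eLpNorm_two_sq] at h
  have h1 := ENNReal.Tendsto.mul_const (b := ν Set.univ ^ (1 / 2 : ℝ)) (tendsto_zero_of_sq h)
    (Or.inr (ENNReal.rpow_ne_top_of_nonneg (by norm_num) (measure_ne_top _ _)))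
  rw [zero_mul] at h1
  refine tendsto_of_tendsto_of_tendsto_of_le_of_le tendsto_const_nhds h1 (fun _ => zero_le)
    fun k => ?_
  dsimp only
  rw [← eLpNorm_one_eq_lintegral_enorm]
  refine (eLpNorm_le_eLpNorm_mul_rpow_measure_univ (p := 1) (q := 2) (by norm_num)
    (hf k)).trans (le_of_eq ?_)
  norm_num

/-- The limit form of integration by parts for a function with smooth approximations. -/
theorem tendsto_integral_pderiv_mul {κ ℓ : ℝ} {i : Fin 3} {f g : E 3 → ℂ} {φ : ℕ → E 3 → ℂ}
    (hf : MemLp f 2 (volume.restrict (cylinder κ ℓ)))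
    (hg : MemLp g 2 (volume.restrict (cylinder κ ℓ)))
    (hφ : ∀ k, ContDiff ℝ ∞ (φ k))
    (hlim : Tendsto (fun k => eLpNorm (fun x => φ k x - f x) 2 (volume.restrict (cylinder κ ℓ)))
      atTop (𝓝 0))
    (hlim' : Tendsto
      (fun k => eLpNorm (fun x => pderiv i (φ k) x - g x) 2 (volume.restrict (cylinder κ ℓ)))
      atTop (𝓝 0)) {χ : E 3 → ℂ} (hχ : ContDiff ℝ ∞ χ) :
    Tendsto (fun k => ∫ x in cylinder κ ℓ, pderiv i (fun x => φ k x * χ x) x) atTop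
      (𝓝 ((∫ x in cylinder κ ℓ, f x * pderiv i χ x) + ∫ x in cylinder κ ℓ, g x * χ x)) := by
  have hae : ∀ {C : ℝ} {k : E 3 → ℂ}, (∀ x ∈ cylinder κ ℓ, ‖k x‖ ≤ C) →
      ∀ᵐ x ∂(volume.restrict (cylinder κ ℓ)), ‖k x‖ ≤ C := fun hC =>
    (ae_restrict_mem (measurableSet_cylinder κ ℓ)).mono hC
  obtain ⟨C, -, hC⟩ := exists_bound_cylinder κ ℓ (continuous_pderiv hχ i)
  obtain ⟨C', -, hC'⟩ := exists_bound_cylinder κ ℓ hχ.continuous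
  have h1 := tendsto_integral_mul_of_bounded hf
    (fun k => memLp_cylinder_of_continuous (hφ k).continuous) hlim
    (continuous_pderiv hχ i).aestronglyMeasurable (hae hC)
  have h2 := tendsto_integral_mul_of_bounded hg
    (fun k => memLp_cylinder_of_continuous (continuous_pderiv (hφ k) i)) hlim'
    hχ.continuous.aestronglyMeasurable (hae hC')
  refine (h1.add h2).congr fun k => ?_
  have hi1 : Integrable (fun x => φ k x * pderiv i χ x) (volume.restrict (cylinder κ ℓ)) :=
    integrable_cylinder_of_continuous κ ℓ ((hφ k).continuous.mul (continuous_pderiv hχ i))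
  have hi2 : Integrable (fun x => pderiv i (φ k) x * χ x) (volume.restrict (cylinder κ ℓ)) :=
    integrable_cylinder_of_continuous κ ℓ ((continuous_pderiv (hφ k) i).mul hχ.continuous)
  rw [← integral_add hi1 hi2]
  exact integral_congr_ae (Eventually.of_forall fun x => (pderiv_mul (hφ k) hχ i x).symm)

/-- In the horizontal directions the boundary term is an integral over the lateral surface, which is
controlled by the traces of the approximations. -/
theorem hasGreenDeriv_horizontal {κ ℓ : ℝ} (hκ : 0 < κ) {i : Fin 2} {f g : E 3 → ℂ}
    {φ : ℕ → E 3 → ℂ}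
    (hf : MemLp f 2 (volume.restrict (cylinder κ ℓ)))
    (hg : MemLp g 2 (volume.restrict (cylinder κ ℓ)))
    (hφ : ∀ k, ContDiff ℝ ∞ (φ k))
    (hlim : Tendsto (fun k => eLpNorm (fun x => φ k x - f x) 2 (volume.restrict (cylinder κ ℓ)))
      atTop (𝓝 0))
    (hlim' : Tendsto (fun k => eLpNorm (fun x => pderiv i.castSucc (φ k) x - g x) 2
      (volume.restrict (cylinder κ ℓ))) atTop (𝓝 0))
    (htr : Tendsto (fun k => ∫⁻ p in Set.Ioo (0 : ℝ) (2 * Real.pi) ×ˢ Set.Ioo (0 : ℝ) ℓ,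
      ‖φ k !₂[κ * Real.cos p.1, κ * Real.sin p.1, p.2]‖ₑ ^ 2 * ENNReal.ofReal κ) atTop (𝓝 0)) :
    HasGreenDeriv κ ℓ i.castSucc f g := by
  intro χ hχ _
  rw [eq_neg_iff_add_eq_zero]
  refine tendsto_nhds_unique (tendsto_integral_pderiv_mul hf hg hφ hlim hlim' hχ) ?_
  set ν : Measure (ℝ × ℝ) :=
    volume.restrict (Set.Ioo (0 : ℝ) (2 * Real.pi) ×ˢ Set.Ioo (0 : ℝ) ℓ) with hν
  have hsub : Set.Ioo (0 : ℝ) (2 * Real.pi) ×ˢ Set.Ioo (0 : ℝ) ℓ ⊆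
      Set.Icc (0 : ℝ) (2 * Real.pi) ×ˢ Set.Icc (0 : ℝ) ℓ :=
    Set.prod_mono Set.Ioo_subset_Icc_self Set.Ioo_subset_Icc_self
  have hK : IsCompact (Set.Icc (0 : ℝ) (2 * Real.pi) ×ˢ Set.Icc (0 : ℝ) ℓ) :=
    isCompact_Icc.prod isCompact_Icc
  have : IsFiniteMeasure ν :=
    ⟨by rw [hν, Measure.restrict_apply_univ]; exact (measure_mono hsub).trans_lt hK.measure_lt_top⟩
  have hP : Continuous fun p : ℝ × ℝ => (!₂[κ * Real.cos p.1, κ * Real.sin p.1, p.2] : E 3) :=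
    continuous_vec3 (by fun_prop) (by fun_prop) (by fun_prop)
  obtain ⟨C, hC⟩ := hK.exists_bound_of_continuousOn (hχ.continuous.comp hP).continuousOn
  have h1 : Tendsto (fun k => ∫⁻ p, ‖φ k !₂[κ * Real.cos p.1, κ * Real.sin p.1, p.2]‖ₑ ∂ν)
      atTop (𝓝 0) := by
    refine tendsto_lintegral_enorm_of_sq
      (fun k => ((hφ k).continuous.comp hP).aestronglyMeasurable) ?_
    have h2 := ENNReal.Tendsto.mul_const (b := ENNReal.ofReal κ⁻¹) htr
      (Or.inr ENNReal.ofReal_ne_top)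
    rw [zero_mul] at h2
    refine h2.congr fun k => ?_
    rw [lintegral_mul_const' _ _ ENNReal.ofReal_ne_top, mul_assoc,
      ← ENNReal.ofReal_mul hκ.le, mul_inv_cancel₀ hκ.ne', ENNReal.ofReal_one, mul_one]
  have h3 := ENNReal.Tendsto.const_mul (a := ENNReal.ofReal C * ENNReal.ofReal κ) h1
    (Or.inr (ENNReal.mul_ne_top ENNReal.ofReal_ne_top ENNReal.ofReal_ne_top))
  rw [mul_zero] at h3
  rw [tendsto_zero_iff_enorm_tendsto_zero]
  refine tendsto_of_tendsto_of_tendsto_of_le_of_le tendsto_const_nhds h3 (fun _ => zero_le)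
    fun k => ?_
  refine (enorm_integral_cylinder_pderiv_le hκ ℓ ((hφ k).mul hχ) i).trans ?_
  rw [← lintegral_const_mul' _ _ (ENNReal.mul_ne_top ENNReal.ofReal_ne_top ENNReal.ofReal_ne_top)]
  refine lintegral_mono_ae ?_
  filter_upwards [ae_restrict_mem (measurableSet_Ioo.prod measurableSet_Ioo)] with p hp
  rw [enorm_mul, mul_comm (ENNReal.ofReal C), mul_comm (_ * _) (ENNReal.ofReal κ), mul_assoc,
    mul_comm ‖φ k _‖ₑ]
  gcongr
  rw [← ofReal_norm]
  exact ENNReal.ofReal_le_ofReal (hC p (hsub hp))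

theorem tendsto_integral_mul_zero {κ : ℝ} {ι : Type*} {l : Filter ι} {g : ι → E 2 → ℂ}
    (hg : ∀ n, MemLp (g n) 2 (volume.restrict (disk κ)))
    (hlim : Tendsto (fun n => ∫ y in disk κ, ‖g n y‖ ^ 2) l (𝓝 0)) {ψ : E 2 → ℂ}
    (hψ : Continuous ψ) : Tendsto (fun n => ∫ y in disk κ, g n y * ψ y) l (𝓝 0) := by
  obtain ⟨C, hC⟩ := (isCompact_closedBall (0 : E 2) |κ|).exists_bound_of_continuousOn hψ.continuousOn
  have h := tendsto_integral_mul_of_bounded (f := fun _ => 0) (μ := volume.restrict (disk κ))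
    (l := l) MemLp.zero' hg ?_ hψ.aestronglyMeasurable (C := C) ?_
  · simpa using h
  · refine tendsto_zero_of_sq ?_
    simp only [sub_zero, eLpNorm_two_sq]
    have h1 := ENNReal.tendsto_ofReal hlim
    rw [ENNReal.ofReal_zero] at h1
    refine h1.congr fun n => ?_
    rw [lintegral_enorm_sq_eq_ofReal ((hg n).integrable_norm_pow (by norm_num))]
  · filter_upwards [ae_restrict_mem (isOpen_disk κ).measurableSet] with y hy
    exact hC y (disk_subset_closedBall κ hy)

/-- The defect `∫ f ∂₂χ + g χ` in integration by parts depends only on the values of `χ` on the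
faces, so for a function `χ` that matches on the faces it is unchanged when `χ` is replaced by a
mode `χ(y, 0) exp (-2π i n z / ℓ)` of arbitrarily high frequency. There it tends to zero by the
decay of the Fourier coefficients. -/
theorem hasGreenDeriv_axial {κ ℓ : ℝ} (hℓ : 0 < ℓ) {f g : E 3 → ℂ} {φ : ℕ → E 3 → ℂ}
    (hf : MemLp f 2 (volume.restrict (cylinder κ ℓ)))
    (hg : MemLp g 2 (volume.restrict (cylinder κ ℓ)))
    (hφ : ∀ k, ContDiff ℝ ∞ (φ k))
    (hlim : Tendsto (fun k => eLpNorm (fun x => φ k x - f x) 2 (volume.restrict (cylinder κ ℓ)))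
      atTop (𝓝 0))
    (hlim' : Tendsto (fun k => eLpNorm (fun x => pderiv 2 (φ k) x - g x) 2
      (volume.restrict (cylinder κ ℓ))) atTop (𝓝 0))
    (hsum : Tendsto (fun n : ℤ => (2 * Real.pi * n) ^ 2 / ℓ *
      ∫ y in disk κ, ‖axialCoeff ℓ f n y‖ ^ 2) cofinite (𝓝 0)) :
    HasGreenDeriv κ ℓ 2 f g := by
  intro χ hχ hm
  rw [eq_neg_iff_add_eq_zero]
  have hvan : ∀ η : E 3 → ℂ, ContDiff ℝ ∞ η → (∀ x, x 2 = 0 → η x = 0) →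
      (∀ x, x 2 = ℓ → η x = 0) →
      (∫ x in cylinder κ ℓ, f x * pderiv 2 η x) + ∫ x in cylinder κ ℓ, g x * η x = 0 := by
    intro η hη h0 h1
    refine tendsto_nhds_unique (tendsto_integral_pderiv_mul hf hg hφ hlim hlim' hη) ?_
    refine tendsto_const_nhds.congr fun k => (integral_cylinder_pderiv_two κ hℓ
      ((hφ k).mul hη) fun x hx => ?_).symm
    rw [h0 x hx, h1 _ (by simp [hx]), mul_zero, mul_zero]
  set ψ : E 2 → ℂ := fun y => χ !₂[y 0, y 1, 0] with hψdef
  have hψ : ContDiff ℝ ∞ ψ :=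
    hχ.comp (contDiff_vec3 (contDiff_coord 0) (contDiff_coord 1) contDiff_const)
  have hmode0 : ∀ (n : ℤ) (x : E 3), x 2 = 0 → axialMode ℓ ψ n x = χ x := by
    intro n x hx
    have : (!₂[x 0, x 1, 0] : E 3) = x := by
      ext i; fin_cases i <;> simp [hx]
    simp [axialMode, hψdef, hx, this]
  have hL : ∀ n : ℤ, (∫ x in cylinder κ ℓ, f x * pderiv 2 χ x) + ∫ x in cylinder κ ℓ, g x * χ x =
      ℓ * (-(∫ y in disk κ, (2 * Real.pi * Complex.I * n / ℓ * axialCoeff ℓ f n y) * ψ y) +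
        ∫ y in disk κ, axialCoeff ℓ g n y * ψ y) := by
    intro n
    have hM := contDiff_axialMode ℓ hψ n
    have h1 := hvan (fun x => χ x - axialMode ℓ ψ n x) (hχ.sub hM)
      (fun x hx => by rw [hmode0 n x hx, sub_self]) fun x hx => by
        have hx' : x = (x - EuclideanSpace.single 2 ℓ) + EuclideanSpace.single 2 ℓ := by simp
        have h0 : (x - EuclideanSpace.single 2 ℓ : E 3) 2 = 0 := by simp [hx]
        rw [hx', hm _ h0, axialMode_add_single hℓ, hmode0 n _ h0, sub_self]
    simp only [pderiv_sub hχ hM, mul_sub] at h1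
    rw [integral_sub (integrable_mul_continuous hf (continuous_pderiv hχ 2))
      (integrable_mul_continuous hf (continuous_pderiv hM 2)),
      integral_sub (integrable_mul_continuous hg hχ.continuous)
      (integrable_mul_continuous hg hM.continuous)] at h1
    have h2 : ∫ x in cylinder κ ℓ, f x * pderiv 2 (axialMode ℓ ψ n) x =
        -(2 * Real.pi * Complex.I * n / ℓ) * ∫ x in cylinder κ ℓ, f x * axialMode ℓ ψ n x := by
      rw [← integral_const_mul]
      refine integral_congr_ae (Eventually.of_forall fun x => ?_)
      dsimp only
      rw [pderiv_two_axialMode ℓ hψ]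
      ring
    rw [h2, integral_mul_axialMode hℓ hf hψ.continuous,
      integral_mul_axialMode hℓ hg hψ.continuous] at h1
    simp only [mul_assoc, integral_const_mul] at h1 ⊢
    linear_combination h1
  have ht1 : Tendsto (fun n : ℤ => ∫ y in disk κ,
      (2 * Real.pi * Complex.I * n / ℓ * axialCoeff ℓ f n y) * ψ y) cofinite (𝓝 0) := by
    refine tendsto_integral_mul_zero (fun n => (memLp_axialCoeff hℓ hf n).const_mul _) ?_
      hψ.continuous
    have h1 := hsum.const_mul ℓ⁻¹
    rw [mul_zero] at h1
    refine h1.congr fun n => ?_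
    rw [← mul_assoc, ← integral_const_mul]
    refine integral_congr_ae (Eventually.of_forall fun y => ?_)
    have : ‖2 * Real.pi * Complex.I * n / ℓ‖ = |2 * Real.pi * n| / ℓ := by
      simp [abs_mul, abs_of_pos hℓ]
    dsimp only
    rw [norm_mul, this, mul_pow (|_| / _), div_pow, sq_abs]
    field_simp
  have ht2 : Tendsto (fun n : ℤ => ∫ y in disk κ, axialCoeff ℓ g n y * ψ y) cofinite (𝓝 0) :=
    tendsto_integral_mul_zero (fun n => memLp_axialCoeff hℓ hg n)
      (summable_axialCoeff hℓ hg).tendsto_cofinite_zero hψ.continuous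
  have ht := (ht1.neg.add ht2).const_mul (ℓ : ℂ)
  rw [neg_zero, add_zero, mul_zero] at ht
  exact tendsto_nhds_unique (tendsto_const_nhds.congr hL) ht

theorem hasGreenDeriv_of_mem_H1pZero {κ ℓ : ℝ} (hκ : 0 < κ) (hℓ : 0 < ℓ) {q : L2 κ ℓ}
    (hq : q ∈ H1pZero κ ℓ) {w : L2Vec κ ℓ} (h : IsGradient q w) (i : Fin 3) :
    HasGreenDeriv κ ℓ i q fun x => w x i := by
  obtain ⟨⟨-, G', -, hsum⟩, G, hG, φ, hφ, hφlim, hGlim, htr⟩ := hq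
  have hwlim : ∀ i, Tendsto (fun k => eLpNorm (fun x => pderiv i (φ k) x - w x i) 2
      (volume.restrict (cylinder κ ℓ))) atTop (𝓝 0) := by
    intro i
    refine (hGlim i).congr fun k => eLpNorm_congr_ae ?_
    have hi : ∀ {g : E 3 → ℂ}, MemLp g 2 (volume.restrict (cylinder κ ℓ)) →
        IntegrableOn g (cylinder κ ℓ) := fun hg => hg.integrable (by norm_num)
    filter_upwards [(hG.2 i).2.ae_eq (isOpen_cylinder κ ℓ) (hi (hG.2 i).1)
      (hi (memLp_component w i)) (h i)] with x hx
    rw [hx]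
  induction i using Fin.lastCases with
  | cast i =>
    exact hasGreenDeriv_horizontal hκ (Lp.memLp q) (memLp_component w _) hφ hφlim (hwlim _)
      (by simpa using htr)
  | last =>
    refine hasGreenDeriv_axial hℓ (Lp.memLp q) (memLp_component w _) hφ hφlim (hwlim _) ?_
    refine squeeze_zero (fun n => ?_) (fun n => ?_) hsum.tendsto_cofinite_zero
    · exact mul_nonneg (by positivity) (integral_nonneg fun y => by positivity)
    · have h1 : 0 ≤ ∫ y in disk κ, ‖axialCoeff ℓ q n y‖ ^ 2 :=
        integral_nonneg fun y => by positivity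
      have h2 : 0 ≤ ∑ i, ∫ y in disk κ, ‖G' n i y‖ ^ 2 :=
        Finset.sum_nonneg fun i _ => integral_nonneg fun y => by positivity
      have := mul_nonneg hℓ.le (add_nonneg h1 h2)
      linarith

/-! ### Mollification of the periodic extension -/

/-- The periodic extension of `f` in the axial variable, by zero outside the infinite cylinder
(and on the planes through the faces). -/
def periodicExt (κ ℓ : ℝ) (f : E 3 → ℂ) (x : E 3) : ℂ :=
  (cylinder κ ℓ).indicator f (x - EuclideanSpace.single 2 (⌊x 2 / ℓ⌋ * ℓ))

/-- Three consecutive periods of the periodic extension. -/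
def threePeriods (κ ℓ : ℝ) (f : E 3 → ℂ) (x : E 3) : ℂ :=
  (cylinder κ ℓ).indicator f (x + EuclideanSpace.single 2 ℓ) + (cylinder κ ℓ).indicator f x +
    (cylinder κ ℓ).indicator f (x - EuclideanSpace.single 2 ℓ)

theorem indicator_cylinder_eq_zero {κ ℓ : ℝ} (f : E 3 → ℂ) {x : E 3} (h : x 2 ≤ 0 ∨ ℓ ≤ x 2) :
    (cylinder κ ℓ).indicator f x = 0 := by
  refine Set.indicator_of_notMem (fun hx => ?_) f
  rcases h with h | h
  · exact absurd hx.2.1 (not_lt.2 h)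
  · exact absurd hx.2.2 (not_lt.2 h)

theorem periodicExt_eq_threePeriods {κ ℓ : ℝ} (hℓ : 0 < ℓ) (f : E 3 → ℂ) {x : E 3}
    (h1 : -ℓ ≤ x 2) (h2 : x 2 < 2 * ℓ) : periodicExt κ ℓ f x = threePeriods κ ℓ f x := by
  unfold periodicExt threePeriods
  rcases lt_or_ge (x 2) 0 with h | h
  · have hf : ⌊x 2 / ℓ⌋ = -1 := by
      rw [Int.floor_eq_iff, le_div_iff₀ hℓ, div_lt_iff₀ hℓ]
      push_cast
      constructor <;> linarith
    rw [indicator_cylinder_eq_zero f (x := x) (Or.inl h.le),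
      indicator_cylinder_eq_zero f (x := x - EuclideanSpace.single 2 ℓ) (Or.inl (by simp; linarith)), hf]
    have he : x - EuclideanSpace.single 2 (((-1 : ℤ) : ℝ) * ℓ) = x + EuclideanSpace.single 2 ℓ := by
      ext i; fin_cases i <;> simp
    rw [he, add_zero, add_zero]
  rcases lt_or_ge (x 2) ℓ with h' | h'
  · have hf : ⌊x 2 / ℓ⌋ = 0 := by
      rw [Int.floor_eq_iff, le_div_iff₀ hℓ, div_lt_iff₀ hℓ]
      push_cast
      constructor <;> linarith
    rw [indicator_cylinder_eq_zero f (x := x + EuclideanSpace.single 2 ℓ) (Or.inr (by simp; linarith)),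
      indicator_cylinder_eq_zero f (x := x - EuclideanSpace.single 2 ℓ) (Or.inl (by simp; linarith)), hf]
    have he : x - EuclideanSpace.single 2 (((0 : ℤ) : ℝ) * ℓ) = x := by
      ext i; fin_cases i <;> simp
    rw [he, zero_add, add_zero]
  · have hf : ⌊x 2 / ℓ⌋ = 1 := by
      rw [Int.floor_eq_iff, le_div_iff₀ hℓ, div_lt_iff₀ hℓ]
      push_cast
      constructor <;> linarith
    rw [indicator_cylinder_eq_zero f (x := x + EuclideanSpace.single 2 ℓ) (Or.inr (by simp; linarith)),
      indicator_cylinder_eq_zero f (x := x) (Or.inr h'), hf]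
    simp

theorem periodicExt_add_zsmul {κ ℓ : ℝ} (hℓ : 0 < ℓ) (f : E 3 → ℂ) (x : E 3) (m : ℤ) :
    periodicExt κ ℓ f (x + EuclideanSpace.single 2 (m * ℓ)) = periodicExt κ ℓ f x := by
  unfold periodicExt
  have hf : ⌊(x + EuclideanSpace.single 2 (m * ℓ) : E 3) 2 / ℓ⌋ = ⌊x 2 / ℓ⌋ + m := by
    rw [← Int.floor_add_intCast]
    congr 1
    simp
    field_simp
  rw [hf]
  congr 1
  ext i
  fin_cases i <;> simp
  ring

theorem integrable_threePeriods {κ ℓ : ℝ} {f : E 3 → ℂ}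
    (hf : IntegrableOn f (cylinder κ ℓ)) : Integrable (threePeriods κ ℓ f) := by
  have h0 := hf.integrable_indicator (measurableSet_cylinder κ ℓ)
  exact ((h0.comp_add_right _).add h0).add (h0.comp_sub_right _)

theorem locallyIntegrable_periodicExt {κ ℓ : ℝ} (hℓ : 0 < ℓ) {f : E 3 → ℂ}
    (hf : IntegrableOn f (cylinder κ ℓ)) : LocallyIntegrable (periodicExt κ ℓ f) := by
  intro x
  set m := ⌊x 2 / ℓ⌋ with hm
  have h1 : m * ℓ ≤ x 2 := by rw [← le_div_iff₀ hℓ]; exact Int.floor_le _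
  have h2 : x 2 < (m + 1) * ℓ := by rw [← div_lt_iff₀ hℓ]; exact Int.lt_floor_add_one _
  have hc : Continuous fun y : E 3 => y 2 := by fun_prop
  have hU : IsOpen {y : E 3 | (m - 1) * ℓ < y 2 ∧ y 2 < (m + 2) * ℓ} :=
    (isOpen_lt continuous_const hc).inter (isOpen_lt hc continuous_const)
  refine ⟨_, hU.mem_nhds ⟨by nlinarith, by nlinarith⟩, ?_⟩
  have hi : IntegrableOn (fun y => threePeriods κ ℓ f (y - EuclideanSpace.single 2 (m * ℓ)))
      {y : E 3 | (m - 1) * ℓ < y 2 ∧ y 2 < (m + 2) * ℓ} :=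
    ((integrable_threePeriods hf).comp_sub_right _).integrableOn
  refine hi.congr_fun (fun y hy => ?_) hU.measurableSet
  obtain ⟨hy1, hy2⟩ := hy
  have h3 := periodicExt_add_zsmul (κ := κ) hℓ f (y - EuclideanSpace.single 2 (m * ℓ)) m
  rw [sub_add_cancel] at h3
  dsimp only
  rw [h3, periodicExt_eq_threePeriods hℓ f]
  · simp; linarith
  · simp; linarith

/-- A kernel of axial range less than `ℓ`, centred in one period, sees only that period and its two
neighbours. -/
theorem integral_periodicExt_mul {κ ℓ : ℝ} (hℓ : 0 < ℓ) (f : E 3 → ℂ) {k : E 3 → ℂ}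
    (hk : ∀ v : E 3, ℓ ≤ |v 2| → k v = 0) {x : E 3} (h0 : 0 ≤ x 2) (h1 : x 2 ≤ ℓ) :
    ∫ t, periodicExt κ ℓ f t * k (x - t) = ∫ t, threePeriods κ ℓ f t * k (x - t) := by
  refine integral_congr_ae (Eventually.of_forall fun t => ?_)
  by_cases h : ℓ ≤ |(x - t) 2|
  · simp [hk _ h]
  · rw [not_le, abs_lt, PiLp.sub_apply] at h
    dsimp only
    rw [periodicExt_eq_threePeriods hℓ f (by linarith) (by linarith)]

/-- Pairing with three periods amounts to folding the kernel back to `Ω`. -/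
theorem integral_threePeriods_mul {κ ℓ : ℝ} {f : E 3 → ℂ}
    (hf : IntegrableOn f (cylinder κ ℓ)) {k : E 3 → ℂ} (hkc : Continuous k)
    (hks : HasCompactSupport k) (x : E 3) :
    ∫ t, threePeriods κ ℓ f t * k (x - t) = ∫ s in cylinder κ ℓ, f s *
      (k (x + EuclideanSpace.single 2 ℓ - s) + k (x - s) + k (x - EuclideanSpace.single 2 ℓ - s)) := by
  set z := (cylinder κ ℓ).indicator f with hz
  set e : E 3 := EuclideanSpace.single 2 ℓ with he
  have h0 : Integrable z := hf.integrable_indicator (measurableSet_cylinder κ ℓ)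
  obtain ⟨C, hC⟩ := hks.exists_bound_of_continuous hkc
  have hi : ∀ {g : E 3 → ℂ} (a : E 3), Integrable g → Integrable fun t => g t * k (a - t) :=
    fun a hg => hg.mul_bdd (c := C) (by fun_prop) (Eventually.of_forall fun t => hC _)
  have e1 : ∫ t, z (t + e) * k (x - t) = ∫ s, z s * k (x + e - s) := by
    rw [← integral_add_right_eq_self (fun s => z s * k (x + e - s)) e]
    refine integral_congr_ae (Eventually.of_forall fun t => ?_)
    dsimp only
    congr 2
    abel
  have e2 : ∫ t, z (t - e) * k (x - t) = ∫ s, z s * k (x - e - s) := by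
    rw [← integral_sub_right_eq_self (fun s => z s * k (x - e - s)) e]
    refine integral_congr_ae (Eventually.of_forall fun t => ?_)
    dsimp only
    congr 2
    abel
  have e3 : ∀ t, threePeriods κ ℓ f t * k (x - t) =
      (z (t + e) * k (x - t) + z t * k (x - t)) + z (t - e) * k (x - t) := by
    intro t
    simp only [threePeriods, ← hz, ← he]
    ring
  have hadd : ∀ {a b c : E 3 → ℂ}, Integrable a → Integrable b → Integrable c →
      ∫ t, ((a t + b t) + c t) = (∫ t, a t) + (∫ t, b t) + ∫ t, c t := by
    intro a b c ha hb hc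
    rw [integral_add (f := fun t => a t + b t) (ha.add hb) hc, integral_add ha hb]
  simp only [e3]
  rw [hadd (hi x (h0.comp_add_right e)) (hi x h0) (hi x (h0.comp_sub_right e)), e1, e2,
    ← hadd (hi _ h0) (hi _ h0) (hi _ h0), ← integral_indicator (measurableSet_cylinder κ ℓ)]
  refine integral_congr_ae (Eventually.of_forall fun s => ?_)
  by_cases hs : s ∈ cylinder κ ℓ
  · simp only [hz, Set.indicator_of_mem hs]
    ring
  · simp [hz, Set.indicator_of_notMem hs]

/-- The convolution with a smooth kernel of the periodic extension. -/
def mollify (κ ℓ : ℝ) (f k : E 3 → ℂ) : E 3 → ℂ :=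
  convolution (periodicExt κ ℓ f) k (ContinuousLinearMap.mul ℝ ℂ) volume

theorem mollify_apply (κ ℓ : ℝ) (f k : E 3 → ℂ) (x : E 3) :
    mollify κ ℓ f k x = ∫ t, periodicExt κ ℓ f t * k (x - t) := rfl

theorem contDiff_mollify {κ ℓ : ℝ} (hℓ : 0 < ℓ) {f k : E 3 → ℂ}
    (hf : IntegrableOn f (cylinder κ ℓ)) (hk : ContDiff ℝ ∞ k) (hks : HasCompactSupport k) :
    ContDiff ℝ ∞ (mollify κ ℓ f k) :=
  hks.contDiff_convolution_right _ (locallyIntegrable_periodicExt hℓ hf) hk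

theorem pderiv_mollify {κ ℓ : ℝ} (hℓ : 0 < ℓ) {f k : E 3 → ℂ}
    (hf : IntegrableOn f (cylinder κ ℓ)) (hk : ContDiff ℝ ∞ k) (hks : HasCompactSupport k)
    (i : Fin 3) (x : E 3) : pderiv i (mollify κ ℓ f k) x = mollify κ ℓ f (pderiv i k) x := by
  have h := hks.hasFDerivAt_convolution_right (ContinuousLinearMap.mul ℝ ℂ)
    (locallyIntegrable_periodicExt hℓ hf) (hk.of_le (by simp)) x
  unfold pderiv mollify
  rw [h.fderiv, convolution_precompR_apply _ (locallyIntegrable_periodicExt hℓ hf)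
    (hks.fderiv (𝕜 := ℝ)) (hk.continuous_fderiv (by simp))]

theorem mollify_add_single {κ ℓ : ℝ} (hℓ : 0 < ℓ) (f k : E 3 → ℂ) (x : E 3) :
    mollify κ ℓ f k (x + EuclideanSpace.single 2 ℓ) = mollify κ ℓ f k x := by
  rw [mollify_apply, mollify_apply, ← integral_add_right_eq_self _ (EuclideanSpace.single 2 ℓ)]
  refine integral_congr_ae (Eventually.of_forall fun t => ?_)
  have h := periodicExt_add_zsmul (κ := κ) hℓ f t 1
  rw [Int.cast_one, one_mul] at h
  dsimp only
  rw [h]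
  congr 2
  abel

theorem pderiv_comp_const_sub {k : E 3 → ℂ} (hk : ContDiff ℝ ∞ k) (i : Fin 3) (a s : E 3) :
    pderiv i (fun s => k (a - s)) s = -pderiv i k (a - s) := by
  have h := (hk.differentiable (by simp) (a - s)).hasFDerivAt.comp s
    ((hasFDerivAt_id s).const_sub a)
  have he : fderiv ℝ (fun s => k (a - s)) s = _ := h.fderiv
  unfold pderiv
  rw [he]
  simp

/-- Mollification commutes with differentiation inside a period. -/
theorem HasGreenDeriv.pderiv_mollify {κ ℓ : ℝ} (hℓ : 0 < ℓ) {i : Fin 3} {f g k : E 3 → ℂ}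
    (h : HasGreenDeriv κ ℓ i f g) (hf : IntegrableOn f (cylinder κ ℓ))
    (hg : IntegrableOn g (cylinder κ ℓ)) (hk : ContDiff ℝ ∞ k) (hks : HasCompactSupport k)
    (hk0 : ∀ v : E 3, ℓ ≤ |v 2| → k v = 0) {x : E 3} (h0 : 0 < x 2) (h1 : x 2 < ℓ) :
    pderiv i (mollify κ ℓ f k) x = mollify κ ℓ g k x := by
  set e : E 3 := EuclideanSpace.single 2 ℓ with he
  have hcs : HasCompactSupport (pderiv i k) := by
    have := hks.fderiv (𝕜 := ℝ)
    exact this.comp_left (g := fun L : E 3 →L[ℝ] ℂ => L (EuclideanSpace.single i 1)) (by simp)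
  -- vanishing of the kernel for large axial displacement passes to its derivatives
  have hk0' : ∀ v : E 3, ℓ < |v 2| → pderiv i k v = 0 := by
    intro v hv
    have hopen : IsOpen {v : E 3 | ℓ < |v 2|} := isOpen_lt continuous_const (by fun_prop)
    have hev : k =ᶠ[𝓝 v] fun _ => 0 := by
      filter_upwards [hopen.mem_nhds hv] with u hu
      exact hk0 u (le_of_lt hu)
    unfold pderiv
    rw [hev.fderiv_eq]
    simp
  have hk0'' : ∀ v : E 3, ℓ ≤ |v 2| → pderiv i k v = 0 := by
    intro v hv
    have hcont := continuous_pderiv hk i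
    have hcl : IsClosed {v : E 3 | pderiv i k v = 0} := isClosed_eq hcont continuous_const
    have hlim : Tendsto (fun n : ℕ => (1 + 1 / ((n : ℝ) + 1)) • v) atTop (𝓝 v) := by
      have := (tendsto_one_div_add_atTop_nhds_zero_nat (𝕜 := ℝ)).const_add 1
      simpa using this.smul_const v
    refine hcl.mem_of_tendsto hlim (Eventually.of_forall fun n => hk0' _ ?_)
    have hn : (0 : ℝ) < 1 / ((n : ℝ) + 1) := by positivity
    rw [PiLp.smul_apply, smul_eq_mul, abs_mul, abs_of_pos (by positivity)]
    nlinarith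
  set χ : E 3 → ℂ := fun s => k (x + e - s) + k (x - s) + k (x - e - s) with hχ
  have hsm : ∀ a : E 3, ContDiff ℝ ∞ fun s => k (a - s) := fun a =>
    hk.comp (contDiff_const.sub contDiff_id)
  have hχs : ContDiff ℝ ∞ χ := ((hsm _).add (hsm _)).add (hsm _)
  have hχd : ∀ s, pderiv i χ s = -(pderiv i k (x + e - s) + pderiv i k (x - s) +
      pderiv i k (x - e - s)) := by
    intro s
    rw [hχ, pderiv_add ((hsm _).add (hsm _)) (hsm _), pderiv_add (hsm _) (hsm _),
      pderiv_comp_const_sub hk, pderiv_comp_const_sub hk, pderiv_comp_const_sub hk]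
    ring
  have hfm : FacesMatch ℓ χ := by
    intro s hs
    simp only [hχ, ← he]
    have a1 : x + e - (s + e) = x - s := by abel
    have a2 : x - (s + e) = x - e - s := by abel
    rw [a1, a2, hk0 (x + e - s), hk0 (x - e - (s + e))]
    · ring
    · simp [he, hs]; rw [abs_of_neg (by linarith)]; linarith
    · simp [he, hs]; rw [abs_of_pos (by linarith)]; linarith
  have key := h χ hχs hfm
  rw [Jet.pderiv_mollify hℓ hf hk hks, mollify_apply, mollify_apply,
    integral_periodicExt_mul hℓ f hk0'' h0.le h1.le, integral_periodicExt_mul hℓ g hk0 h0.le h1.le,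
    integral_threePeriods_mul hf (continuous_pderiv hk i) hcs,
    integral_threePeriods_mul hg hk.continuous hks]
  simp only [hχd, mul_neg, integral_neg, neg_inj] at key
  exact key

/-! ### Convergence of mollifications and dilations in `L²` -/

/-- The dilation `(c x₀, c x₁, x₂)` of the horizontal variables. -/
def dilation (c : ℝ) : E 3 →L[ℝ] E 3 :=
  LinearMap.toContinuousLinearMap (Matrix.toEuclideanLin (Matrix.diagonal ![c, c, 1]))

theorem dilation_apply (c : ℝ) (x : E 3) : dilation c x = !₂[c * x 0, c * x 1, x 2] := by
  ext i
  simp only [dilation, LinearMap.coe_toContinuousLinearMap', Matrix.toLpLin_apply,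
    Matrix.mulVec_diagonal]
  fin_cases i <;> simp

theorem det_dilation (c : ℝ) : LinearMap.det (dilation c : E 3 →ₗ[ℝ] E 3) = c ^ 2 := by
  have h : (dilation c : E 3 →ₗ[ℝ] E 3) = Matrix.toEuclideanLin (Matrix.diagonal ![c, c, 1]) := rfl
  rw [h, Matrix.toEuclideanLin_eq_toLin_orthonormal, LinearMap.det_toLin, Matrix.det_diagonal,
    Fin.prod_univ_three]
  simp [sq]

theorem norm_dilation_sub_le {c : ℝ} (hc : 1 ≤ c) (x : E 3) :
    ‖dilation c x - x‖ ≤ (c - 1) * ‖x‖ := by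
  have h0 : 0 ≤ c - 1 := by linarith
  refine abs_le_of_sq_le_sq' ?_ (by positivity) |>.2
  rw [mul_pow, EuclideanSpace.norm_sq_eq, EuclideanSpace.norm_sq_eq, Fin.sum_univ_three,
    Fin.sum_univ_three]
  simp only [dilation_apply, PiLp.sub_apply, Real.norm_eq_abs, sq_abs, Matrix.cons_val_zero,
    Matrix.cons_val_one, Matrix.cons_val]
  nlinarith [mul_nonneg (sq_nonneg (c - 1)) (sq_nonneg (x 2))]

theorem lintegral_comp_dilation_le {c : ℝ} (hc : 1 ≤ c) {h : E 3 → ENNReal} (hh : Measurable h)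
    (t : E 3) : ∫⁻ x, h (dilation c x - t) ≤ ∫⁻ x, h x := by
  have hdet : LinearMap.det (dilation c : E 3 →ₗ[ℝ] E 3) ≠ 0 := by
    rw [det_dilation]; positivity
  have hmap := Measure.map_linearMap_addHaar_eq_smul_addHaar (volume : Measure (E 3)) hdet
  have h1 : ∫⁻ x, h (dilation c x - t) = ∫⁻ y, h (y - t) ∂(Measure.map (dilation c) volume) :=
    (lintegral_map (f := fun y => h (y - t)) (hh.comp (measurable_id.sub_const t))
      (dilation c).continuous.measurable).symm
  rw [h1]
  change ∫⁻ y, h (y - t) ∂(Measure.map (dilation c : E 3 →ₗ[ℝ] E 3) volume) ≤ _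
  rw [hmap, lintegral_smul_measure, lintegral_sub_right_eq_self, det_dilation]
  refine mul_le_of_le_one_left zero_le ?_
  rw [ENNReal.ofReal_le_one, abs_of_pos (by positivity)]
  exact inv_le_one_of_one_le₀ (one_le_pow₀ hc)

theorem eLpNorm_comp_dilation_le {c : ℝ} (hc : 1 ≤ c) {h : E 3 → ℂ} (hh : StronglyMeasurable h)
    (t : E 3) : eLpNorm (fun x => h (dilation c x - t)) 2 volume ≤ eLpNorm h 2 volume := by
  refine (ENNReal.pow_le_pow_left_iff two_ne_zero).1 ?_
  rw [eLpNorm_two_sq, eLpNorm_two_sq]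
  exact lintegral_comp_dilation_le hc (hh.enorm.pow_const 2) t

/-- Continuity in `L²` of dilations and translations, by approximation with continuous functions
of compact support. -/
theorem eventually_eLpNorm_dilation_sub_le {κ ℓ : ℝ} {G : E 3 → ℂ} (hG : StronglyMeasurable G)
    (hG2 : MemLp G 2 volume) {c ε : ℕ → ℝ} (hc : ∀ k, 1 ≤ c k) (hclim : Tendsto c atTop (𝓝 1))
    (hεlim : Tendsto ε atTop (𝓝 0)) {δ : ENNReal} (hδ : δ ≠ 0) :
    ∀ᶠ k in atTop, ∀ t : E 3, ‖t‖ < ε k →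
      eLpNorm (fun x => G (dilation (c k) x - t) - G x) 2 (volume.restrict (cylinder κ ℓ)) ≤ δ := by
  wlog hδtop : δ ≠ ⊤ generalizing δ
  · rw [not_not] at hδtop
    simp [hδtop]
  set μ := volume.restrict (cylinder κ ℓ) with hμ
  have hδ3 : δ / 3 ≠ 0 := by simp [hδ]
  obtain ⟨g, hgs, hgle, hgc, hg2⟩ := hG2.exists_hasCompactSupport_eLpNorm_sub_le (by norm_num) hδ3
  obtain ⟨R, hR0, hR⟩ : ∃ R : ℝ, 0 < R ∧ ∀ x ∈ cylinder κ ℓ, ‖x‖ ≤ R := by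
    obtain ⟨K, hK, hsub⟩ := cylinder_subset_compact κ ℓ
    obtain ⟨R, hR0, hR⟩ := hK.isBounded.exists_pos_norm_le
    exact ⟨R, hR0, fun x hx => hR x (hsub hx)⟩
  -- the uniform bound for the continuous approximation
  obtain ⟨η, hη0, hη⟩ : ∃ η : ℝ, 0 < η ∧
      μ Set.univ ^ ((2 : ENNReal).toReal⁻¹) * ENNReal.ofReal η ≤ δ / 3 := by
    have hlim : Tendsto (fun η : ℝ => μ Set.univ ^ ((2 : ENNReal).toReal⁻¹) * ENNReal.ofReal η)
        (𝓝[>] 0) (𝓝 0) := by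
      have h1 : Tendsto (fun η : ℝ => ENNReal.ofReal η) (𝓝[>] 0) (𝓝 0) := by
        have := (ENNReal.continuous_ofReal.tendsto 0).mono_left (nhdsWithin_le_nhds (s := Set.Ioi 0))
        simpa using this
      have := ENNReal.Tendsto.const_mul (a := μ Set.univ ^ ((2 : ENNReal).toReal⁻¹)) h1
        (Or.inr (ENNReal.rpow_ne_top_of_nonneg (by norm_num) (measure_ne_top _ _)))
      simpa using this
    have h2 := (hlim.eventually (gt_mem_nhds (pos_iff_ne_zero.2 hδ3))).and self_mem_nhdsWithin
    obtain ⟨η, h3, h4⟩ := h2.exists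
    exact ⟨η, h4, h3.le⟩
  obtain ⟨τ, hτ0, hτ⟩ := Metric.uniformContinuous_iff.1
    (hgs.uniformContinuous_of_continuous hgc) η hη0
  have hev : ∀ᶠ k in atTop, (c k - 1) * R + ε k < τ := by
    have : Tendsto (fun k => (c k - 1) * R + ε k) atTop (𝓝 0) := by
      simpa using ((hclim.sub_const 1).mul_const R).add hεlim
    exact this.eventually (gt_mem_nhds hτ0)
  filter_upwards [hev] with k hk t ht
  have hgm : StronglyMeasurable g := hgc.stronglyMeasurable
  have hD : Continuous fun x => dilation (c k) x - t := by fun_prop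
  have m1 : AEStronglyMeasurable (fun x => (G - g) (dilation (c k) x - t)) μ :=
    ((hG.sub hgm).comp_measurable hD.measurable).aestronglyMeasurable
  have m2 : AEStronglyMeasurable (fun x => g (dilation (c k) x - t) - g x) μ :=
    ((hgc.comp hD).sub hgc).aestronglyMeasurable
  have m3 : AEStronglyMeasurable (G - g) μ := (hG.sub hgm).aestronglyMeasurable
  have he : (fun x => G (dilation (c k) x - t) - G x) =
      ((fun x => (G - g) (dilation (c k) x - t)) + fun x => g (dilation (c k) x - t) - g x) -
        (G - g) := by
    funext x
    simp
  rw [he]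
  have b1 : eLpNorm (fun x => (G - g) (dilation (c k) x - t)) 2 μ ≤ δ / 3 :=
    ((eLpNorm_mono_measure _ Measure.restrict_le_self).trans
      (eLpNorm_comp_dilation_le (hc k) (hG.sub hgm) t)).trans hgle
  have b2 : eLpNorm (fun x => g (dilation (c k) x - t) - g x) 2 μ ≤ δ / 3 := by
    refine (eLpNorm_le_of_ae_bound (C := η) ?_).trans hη
    filter_upwards [ae_restrict_mem (measurableSet_cylinder κ ℓ)] with x hx
    rw [← dist_eq_norm]
    refine (hτ ?_).le
    rw [dist_eq_norm]
    calc ‖dilation (c k) x - t - x‖ = ‖(dilation (c k) x - x) - t‖ := by congr 1; abel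
      _ ≤ ‖dilation (c k) x - x‖ + ‖t‖ := norm_sub_le _ _
      _ ≤ (c k - 1) * R + ε k := by
        refine add_le_add ((norm_dilation_sub_le (hc k) x).trans ?_) ht.le
        exact mul_le_mul_of_nonneg_left (hR x hx) (by linarith [hc k])
      _ < τ := hk
  have b3 : eLpNorm (G - g) 2 μ ≤ δ / 3 :=
    (eLpNorm_mono_measure _ Measure.restrict_le_self).trans hgle
  calc _ ≤ _ := eLpNorm_sub_le (m1.add m2) m3 (by norm_num)
    _ ≤ (δ / 3 + δ / 3) + δ / 3 := by
      gcongr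
      exact (eLpNorm_add_le m1 m2 (by norm_num)).trans (add_le_add b1 b2)
    _ = δ := ENNReal.add_thirds δ

/-- Jensen's inequality for the square and a probability density. -/
theorem enorm_integral_sub_sq_le {ρ : E 3 → ℝ} (hρc : Continuous ρ) (hρ0 : ∀ t, 0 ≤ ρ t)
    (hρi : Integrable ρ) (hρ1 : ∫ t, ρ t = 1) {h : E 3 → ℂ} (hh : StronglyMeasurable h)
    (hint : Integrable fun t => h t * ρ t) (a : ℂ) :
    ‖(∫ t, h t * ρ t) - a‖ₑ ^ 2 ≤ ∫⁻ t, ENNReal.ofReal (ρ t) * ‖h t - a‖ₑ ^ 2 := by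
  set P : Measure (E 3) := volume.withDensity fun t => ENNReal.ofReal (ρ t) with hP
  have hPm : Measurable fun t => ENNReal.ofReal (ρ t) := hρc.measurable.ennreal_ofReal
  have hPp : IsProbabilityMeasure P := ⟨by
    rw [hP, withDensity_apply _ MeasurableSet.univ, setLIntegral_univ,
      ← ofReal_integral_eq_lintegral_ofReal hρi (Eventually.of_forall hρ0), hρ1, ENNReal.ofReal_one]⟩
  have hhm : StronglyMeasurable fun t => h t - a := hh.sub stronglyMeasurable_const
  have e1 : (∫ t, h t * ρ t) - a = ∫ t, (h t - a) * ρ t := by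
    have : ∫ t, a * (ρ t : ℂ) = a := by
      rw [integral_const_mul, integral_complex_ofReal, hρ1]
      simp
    have hi : Integrable fun t => a * (ρ t : ℂ) := hρi.ofReal.const_mul a
    simp only [sub_mul]
    rw [integral_sub hint hi, this]
  have e2 : ‖∫ t, (h t - a) * ρ t‖ₑ ≤ eLpNorm (fun t => h t - a) 1 P := by
    rw [eLpNorm_one_eq_lintegral_enorm, hP, lintegral_withDensity_eq_lintegral_mul _ hPm hhm.enorm]
    refine (enorm_integral_le_lintegral_enorm _).trans (le_of_eq (lintegral_congr fun t => ?_))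
    rw [enorm_mul, mul_comm, Pi.mul_apply]
    congr 1
    rw [← ofReal_norm, Complex.norm_real, Real.norm_of_nonneg (hρ0 t)]
  rw [e1]
  calc ‖∫ t, (h t - a) * ρ t‖ₑ ^ 2 ≤ eLpNorm (fun t => h t - a) 2 P ^ 2 := by
        gcongr
        exact e2.trans (eLpNorm_le_eLpNorm_of_exponent_le (by norm_num) hhm.aestronglyMeasurable)
    _ = _ := by
        rw [eLpNorm_two_sq, hP, lintegral_withDensity_eq_lintegral_mul _ hPm (hhm.enorm.pow_const 2)]
        rfl

/-- An average of translates `G (D x - t)` over `‖t‖ < r` is as close to `G` as each of the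
translates. -/
theorem eLpNorm_average_sub_le {κ ℓ : ℝ} {ρ : E 3 → ℝ} (hρc : Continuous ρ) (hρ0 : ∀ t, 0 ≤ ρ t)
    (hρi : Integrable ρ) (hρ1 : ∫ t, ρ t = 1) {r : ℝ} (hρr : ∀ t, r ≤ ‖t‖ → ρ t = 0)
    {C : ℝ} (hρC : ∀ t, ‖ρ t‖ ≤ C) {G : E 3 → ℂ} (hG : StronglyMeasurable G) (hGi : Integrable G)
    {D : E 3 → E 3} (hD : Continuous D) {δ : ENNReal}
    (h : ∀ t : E 3, ‖t‖ < r →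
      eLpNorm (fun x => G (D x - t) - G x) 2 (volume.restrict (cylinder κ ℓ)) ≤ δ) :
    eLpNorm (fun x => (∫ t, G (D x - t) * ρ t) - G x) 2 (volume.restrict (cylinder κ ℓ)) ≤ δ := by
  set μ := volume.restrict (cylinder κ ℓ) with hμ
  have hPm : Measurable fun t => ENNReal.ofReal (ρ t) := hρc.measurable.ennreal_ofReal
  have hjoint : Measurable fun p : E 3 × E 3 =>
      ENNReal.ofReal (ρ p.2) * ‖G (D p.1 - p.2) - G p.1‖ₑ ^ 2 := by
    have h1 : StronglyMeasurable fun p : E 3 × E 3 => G (D p.1 - p.2) - G p.1 :=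
      (hG.comp_measurable (by fun_prop : Continuous fun p : E 3 × E 3 => D p.1 - p.2).measurable).sub
        (hG.comp_measurable measurable_fst)
    exact (hPm.comp measurable_snd).mul (h1.enorm.pow_const 2)
  refine (ENNReal.pow_le_pow_left_iff two_ne_zero).1 ?_
  rw [eLpNorm_two_sq]
  calc ∫⁻ x, ‖(∫ t, G (D x - t) * ρ t) - G x‖ₑ ^ 2 ∂μ
      ≤ ∫⁻ x, ∫⁻ t, ENNReal.ofReal (ρ t) * ‖G (D x - t) - G x‖ₑ ^ 2 ∂volume ∂μ := by
        refine lintegral_mono fun x => ?_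
        refine enorm_integral_sub_sq_le hρc hρ0 hρi hρ1 (h := fun t => G (D x - t)) ?_ ?_ _
        · exact hG.comp_measurable (by fun_prop : Continuous fun t => D x - t).measurable
        · exact (hGi.comp_sub_left (D x)).mul_bdd (c := C)
            (Complex.continuous_ofReal.comp hρc).aestronglyMeasurable
            (Eventually.of_forall fun t => by simpa using hρC t)
    _ = ∫⁻ t, ∫⁻ x, ENNReal.ofReal (ρ t) * ‖G (D x - t) - G x‖ₑ ^ 2 ∂μ ∂volume :=
        lintegral_lintegral_swap hjoint.aemeasurable
    _ ≤ ∫⁻ t, ENNReal.ofReal (ρ t) * δ ^ 2 := by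
        refine lintegral_mono fun t => ?_
        dsimp only
        rw [lintegral_const_mul' _ _ ENNReal.ofReal_ne_top]
        by_cases ht : r ≤ ‖t‖
        · simp [hρr t ht]
        · gcongr
          rw [← eLpNorm_two_sq]
          gcongr
          exact h t (not_le.1 ht)
    _ = δ ^ 2 := by
        rw [lintegral_mul_const _ hPm, ← ofReal_integral_eq_lintegral_ofReal hρi
          (Eventually.of_forall hρ0), hρ1, ENNReal.ofReal_one, one_mul]

/-- A smooth bump of integral one, as a complex-valued function. -/
def bumpKernel (b : ContDiffBump (0 : E 3)) (v : E 3) : ℂ := (b.normed volume v : ℝ)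

theorem contDiff_bumpKernel (b : ContDiffBump (0 : E 3)) : ContDiff ℝ ∞ (bumpKernel b) :=
  Complex.ofRealCLM.contDiff.comp b.contDiff_normed

theorem hasCompactSupport_bumpKernel (b : ContDiffBump (0 : E 3)) :
    HasCompactSupport (bumpKernel b) :=
  b.hasCompactSupport_normed.comp_left (g := fun t : ℝ => (t : ℂ)) (by simp)

theorem normed_eq_zero (b : ContDiffBump (0 : E 3)) {v : E 3} (hv : b.rOut ≤ ‖v‖) :
    b.normed volume v = 0 := by
  have h := b.support_normed_eq (μ := volume)
  by_contra hne
  have : v ∈ Metric.ball (0 : E 3) b.rOut := h ▸ Function.mem_support.2 hne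
  rw [mem_ball_zero_iff] at this
  linarith

theorem stronglyMeasurable_threePeriods {κ ℓ : ℝ} {f : E 3 → ℂ} (hf : StronglyMeasurable f) :
    StronglyMeasurable (threePeriods κ ℓ f) := by
  have h0 := hf.indicator (measurableSet_cylinder κ ℓ)
  exact ((h0.comp_measurable (measurable_add_const _)).add h0).add
    (h0.comp_measurable (measurable_sub_const _))

theorem memLp_threePeriods {κ ℓ : ℝ} {f : E 3 → ℂ}
    (hf : MemLp f 2 (volume.restrict (cylinder κ ℓ))) : MemLp (threePeriods κ ℓ f) 2 volume := by
  have h0 := (memLp_indicator_iff_restrict (measurableSet_cylinder κ ℓ)).2 hf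
  exact ((h0.comp_measurePreserving (measurePreserving_add_right volume _)).add h0).add
    (h0.comp_measurePreserving (measurePreserving_sub_right volume _))

theorem threePeriods_eq {κ ℓ : ℝ} (f : E 3 → ℂ) {x : E 3} (hx : x ∈ cylinder κ ℓ) :
    threePeriods κ ℓ f x = f x := by
  unfold threePeriods
  rw [indicator_cylinder_eq_zero f (x := x + EuclideanSpace.single 2 ℓ)
      (Or.inr (by simpa using hx.2.1.le)),
    indicator_cylinder_eq_zero f (x := x - EuclideanSpace.single 2 ℓ)
      (Or.inl (by simpa using hx.2.2.le)), Set.indicator_of_mem hx, zero_add, add_zero]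

theorem bumpKernel_axial_eq_zero {ℓ : ℝ} {b : ContDiffBump (0 : E 3)} (hb : b.rOut < ℓ) {v : E 3}
    (hv : ℓ ≤ |v 2|) : bumpKernel b v = 0 := by
  unfold bumpKernel
  rw [normed_eq_zero b, Complex.ofReal_zero]
  have := PiLp.norm_apply_le v 2
  rw [Real.norm_eq_abs] at this
  linarith

/-- Mollification followed by a dilation converges to the identity in `L²(Ω)`. -/
theorem tendsto_mollify_dilation {κ ℓ : ℝ} (hℓ : 0 < ℓ) {f : E 3 → ℂ} (hfm : StronglyMeasurable f)
    (hf : MemLp f 2 (volume.restrict (cylinder κ ℓ))) {c : ℕ → ℝ} (hc : ∀ k, 1 ≤ c k)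
    (hclim : Tendsto c atTop (𝓝 1)) {b : ℕ → ContDiffBump (0 : E 3)} (hb : ∀ k, (b k).rOut < ℓ)
    (hblim : Tendsto (fun k => (b k).rOut) atTop (𝓝 0)) :
    Tendsto (fun k => eLpNorm (fun x => mollify κ ℓ f (bumpKernel (b k)) (dilation (c k) x) - f x) 2
      (volume.restrict (cylinder κ ℓ))) atTop (𝓝 0) := by
  rw [ENNReal.tendsto_nhds_zero]
  intro δ hδ
  have hG := stronglyMeasurable_threePeriods (κ := κ) (ℓ := ℓ) hfm
  have hfi : IntegrableOn f (cylinder κ ℓ) := hf.integrable (by norm_num)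
  filter_upwards [eventually_eLpNorm_dilation_sub_le (κ := κ) (ℓ := ℓ) hG (memLp_threePeriods hf)
    hc hclim hblim hδ.ne'] with k hk
  obtain ⟨C, hC⟩ := (b k).hasCompactSupport_normed.exists_bound_of_continuous
    ((b k).continuous_normed (μ := volume))
  have h := eLpNorm_average_sub_le (b k).continuous_normed (fun t => (b k).nonneg_normed t)
    (b k).integrable_normed (b k).integral_normed (fun t ht => normed_eq_zero (b k) ht) hC hG
    (integrable_threePeriods hfi) (dilation (c k)).continuous hk
  refine le_trans (le_of_eq (eLpNorm_congr_ae ?_)) h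
  filter_upwards [ae_restrict_mem (measurableSet_cylinder κ ℓ)] with x hx
  have hx2 : (dilation (c k) x) 2 = x 2 := by rw [dilation_apply]; rfl
  rw [threePeriods_eq f hx, mollify_apply, integral_periodicExt_mul hℓ f
    (fun v hv => bumpKernel_axial_eq_zero (hb k) hv) (by rw [hx2]; exact hx.2.1.le)
    (by rw [hx2]; exact hx.2.2.le), ← integral_sub_left_eq_self _ volume (dilation (c k) x)]
  simp only [sub_sub_cancel]
  rfl

/-! ### Density of the gradients of test functions and the decomposition -/

theorem planar_norm_le {κ ε : ℝ} (hκ : 0 ≤ κ) (hε : 0 ≤ ε) {a b c d : ℝ}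
    (h1 : a ^ 2 + b ^ 2 ≤ κ ^ 2) (h2 : c ^ 2 + d ^ 2 ≤ ε ^ 2) :
    (a + c) ^ 2 + (b + d) ^ 2 ≤ (κ + ε) ^ 2 := by
  have h3 : a * c + b * d ≤ κ * ε := by
    refine (abs_le_of_sq_le_sq' ?_ (by positivity)).2
    calc (a * c + b * d) ^ 2 ≤ (a ^ 2 + b ^ 2) * (c ^ 2 + d ^ 2) := by
          nlinarith [sq_nonneg (a * d - b * c)]
      _ ≤ κ ^ 2 * ε ^ 2 := by gcongr
      _ = (κ * ε) ^ 2 := by ring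
  nlinarith

theorem mollify_support {κ ℓ : ℝ} (hκ : 0 ≤ κ) (f : E 3 → ℂ) (b : ContDiffBump (0 : E 3)) {x : E 3}
    (hx : mollify κ ℓ f (bumpKernel b) x ≠ 0) : x 0 ^ 2 + x 1 ^ 2 ≤ (κ + b.rOut) ^ 2 := by
  rw [mollify_apply] at hx
  obtain ⟨t, ht⟩ : ∃ t, periodicExt κ ℓ f t * bumpKernel b (x - t) ≠ 0 := by
    by_contra! h
    exact hx (by simp [h])
  have h1 : t 0 ^ 2 + t 1 ^ 2 ≤ κ ^ 2 := by
    have h : t - EuclideanSpace.single 2 (⌊t 2 / ℓ⌋ * ℓ) ∈ cylinder κ ℓ := by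
      by_contra h
      exact left_ne_zero_of_mul ht (Set.indicator_of_notMem h f)
    simpa using h.1.le
  have h2 : (x - t) 0 ^ 2 + (x - t) 1 ^ 2 ≤ b.rOut ^ 2 := by
    have h : ‖x - t‖ ≤ b.rOut := by
      by_contra! h
      exact right_ne_zero_of_mul ht (by simp [bumpKernel, normed_eq_zero b h.le])
    have h3 := pow_le_pow_left₀ (norm_nonneg _) h 2
    rw [EuclideanSpace.norm_sq_eq, Fin.sum_univ_three] at h3
    simp only [Real.norm_eq_abs, sq_abs] at h3
    nlinarith [sq_nonneg ((x - t) 2)]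
  have h3 := planar_norm_le hκ b.rOut_pos.le h1 h2
  simpa using h3

/-- Mollification enlarges the support by the radius of the kernel, and the dilation shrinks it back
into the interior. -/
theorem isPeriodicTest_mollify_dilation {κ ℓ : ℝ} (hκ : 0 < κ) (hℓ : 0 < ℓ) {f : E 3 → ℂ}
    (hf : IntegrableOn f (cylinder κ ℓ)) (b : ContDiffBump (0 : E 3)) {c : ℝ} (hc : 0 < c)
    (hcb : κ + b.rOut < c * κ) :
    IsPeriodicTest κ ℓ fun x => mollify κ ℓ f (bumpKernel b) (dilation c x) := by
  have hb := b.rOut_pos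
  refine ⟨(contDiff_mollify hℓ hf (contDiff_bumpKernel b) (hasCompactSupport_bumpKernel b)).comp
    (dilation c).contDiff, fun x => ?_, ((κ + b.rOut) / c) ^ 2, ?_, fun x hx => ?_⟩
  · have : dilation c (x + EuclideanSpace.single 2 ℓ) =
        dilation c x + EuclideanSpace.single 2 ℓ := by
      rw [dilation_apply, dilation_apply]
      ext i
      fin_cases i <;> simp
    dsimp only
    rw [this, mollify_add_single hℓ]
  · have : (κ + b.rOut) / c < κ := by rwa [div_lt_iff₀ hc, mul_comm]
    exact pow_lt_pow_left₀ this (by positivity) two_ne_zero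
  · have h := mollify_support hκ.le f b hx
    rw [dilation_apply] at h
    simp only [Matrix.cons_val_zero, Matrix.cons_val_one] at h
    rw [div_pow, le_div_iff₀ (by positivity)]
    linarith

theorem pderiv_comp_dilation {F : E 3 → ℂ} (hF : ContDiff ℝ ∞ F) (c : ℝ) (i : Fin 3) (x : E 3) :
    pderiv i (fun x => F (dilation c x)) x = (![c, c, 1] i : ℝ) * pderiv i F (dilation c x) := by
  have h := (hF.differentiable (by simp) (dilation c x)).hasFDerivAt.comp x
    (dilation c).hasFDerivAt
  have he : fderiv ℝ (fun x => F (dilation c x)) x = _ := h.fderiv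
  have hv : dilation c (EuclideanSpace.single i 1) =
      (![c, c, 1] i : ℝ) • (EuclideanSpace.single i 1 : E 3) := by
    rw [dilation_apply]
    ext j
    fin_cases i <;> fin_cases j <;> simp
  unfold pderiv
  rw [he, ContinuousLinearMap.comp_apply, hv, map_smul, Complex.real_smul]

theorem tendsto_scaled {κ ℓ : ℝ} {f : E 3 → ℂ} {F : ℕ → E 3 → ℂ} {a : ℕ → ℝ}
    (hf : MemLp f 2 (volume.restrict (cylinder κ ℓ)))
    (hF : ∀ k, AEStronglyMeasurable (F k) (volume.restrict (cylinder κ ℓ)))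
    (hlim : Tendsto (fun k => eLpNorm (fun x => F k x - f x) 2 (volume.restrict (cylinder κ ℓ)))
      atTop (𝓝 0)) (ha : Tendsto a atTop (𝓝 1)) :
    Tendsto (fun k => eLpNorm (fun x => (a k : ℂ) * F k x - f x) 2
      (volume.restrict (cylinder κ ℓ))) atTop (𝓝 0) := by
  set μ := volume.restrict (cylinder κ ℓ) with hμ
  have hle : ∀ k, eLpNorm (fun x => (a k : ℂ) * F k x - f x) 2 μ ≤
      ‖a k‖ₑ * eLpNorm (fun x => F k x - f x) 2 μ + ‖a k - 1‖ₑ * eLpNorm f 2 μ := by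
    intro k
    have he : (fun x => (a k : ℂ) * F k x - f x) =
        ((a k • fun x => F k x - f x) + (a k - 1) • f) := by
      funext x
      simp
      ring
    rw [he, ← eLpNorm_const_smul, ← eLpNorm_const_smul]
    exact eLpNorm_add_le (((hF k).sub hf.1).const_smul _) (hf.1.const_smul _) (by norm_num)
  refine tendsto_of_tendsto_of_tendsto_of_le_of_le tendsto_const_nhds ?_ (fun _ => zero_le) hle
  have h1 : Tendsto (fun k => ‖a k‖ₑ) atTop (𝓝 1) := by
    simpa using ha.enorm
  have h2 : Tendsto (fun k => ‖a k - 1‖ₑ) atTop (𝓝 0) := by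
    simpa using (ha.sub_const 1).enorm
  have h3 := (ENNReal.Tendsto.mul h1 (Or.inl one_ne_zero) hlim (Or.inr (by norm_num))).add
    (ENNReal.Tendsto.mul_const h2 (Or.inr hf.2.ne))
  simpa using h3

theorem edist_le_sum_component {κ ℓ : ℝ} (u v : L2Vec κ ℓ) :
    edist u v ≤ ∑ i, eLpNorm (fun x => u x i - v x i) 2 (volume.restrict (cylinder κ ℓ)) := by
  rw [Lp.edist_def]
  calc eLpNorm (⇑u - ⇑v) 2 (volume.restrict (cylinder κ ℓ))
      ≤ eLpNorm (∑ i : Fin 3, fun x => ‖u x i - v x i‖) 2 (volume.restrict (cylinder κ ℓ)) := by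
        refine eLpNorm_mono_real fun x => ?_
        rw [Finset.sum_apply, EuclideanSpace.norm_eq]
        refine Real.sqrt_le_iff.2 ⟨Finset.sum_nonneg fun i _ => norm_nonneg _, ?_⟩
        exact Finset.sum_sq_le_sq_sum_of_nonneg fun i _ => norm_nonneg _
    _ ≤ ∑ i : Fin 3, eLpNorm (fun x => ‖u x i - v x i‖) 2 (volume.restrict (cylinder κ ℓ)) :=
        eLpNorm_sum_le (fun i _ => ((memLp_component u i).1.sub (memLp_component v i).1).norm)
          (by norm_num)
    _ = _ := by simp only [eLpNorm_norm]

/-- A gradient that satisfies integration by parts against all functions matching on the faces is a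
limit of gradients of test functions: mollify the periodic extension, and dilate the horizontal
variables so that the support moves off the lateral surface. -/
theorem mem_closure_of_hasGreenDeriv {κ ℓ : ℝ} (hκ : 0 < κ) (hℓ : 0 < ℓ) {q : L2 κ ℓ}
    {w : L2Vec κ ℓ} (h : ∀ i, HasGreenDeriv κ ℓ i q fun x => w x i) :
    w ∈ (testGradients hκ ℓ).topologicalClosure := by
  set μ := volume.restrict (cylinder κ ℓ) with hμ
  -- the kernel radius must stay below both `ℓ` and the margin `(c - 1) κ` won by the dilation
  set c : ℕ → ℝ := fun k => 1 + 1 / ((k : ℝ) + 1) with hc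
  set ε : ℕ → ℝ := fun k => min κ ℓ / 2 * (1 / ((k : ℝ) + 1)) with hε
  have hm : 0 < min κ ℓ := lt_min hκ hℓ
  have hk0 : ∀ k : ℕ, 0 < 1 / ((k : ℝ) + 1) := fun k => by positivity
  have hk1 : ∀ k : ℕ, 1 / ((k : ℝ) + 1) ≤ 1 := fun k => by
    rw [div_le_one (by positivity)]
    have := Nat.cast_nonneg (α := ℝ) k
    linarith
  have hε0 : ∀ k, 0 < ε k := fun k => mul_pos (by positivity) (hk0 k)
  set b : ℕ → ContDiffBump (0 : E 3) := fun k =>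
    ⟨ε k / 2, ε k, half_pos (hε0 k), half_lt_self (hε0 k)⟩ with hb
  have hlim0 := tendsto_one_div_add_atTop_nhds_zero_nat (𝕜 := ℝ)
  have hclim : Tendsto c atTop (𝓝 1) := by
    have := hlim0.const_add 1
    rwa [add_zero] at this
  have hblim : Tendsto (fun k => (b k).rOut) atTop (𝓝 0) := by
    have := hlim0.const_mul (min κ ℓ / 2)
    rwa [mul_zero] at this
  have hbℓ : ∀ k, (b k).rOut < ℓ := by
    intro k
    change min κ ℓ / 2 * (1 / ((k : ℝ) + 1)) < ℓ
    nlinarith [hk0 k, hk1 k, min_le_right κ ℓ]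
  have hcb : ∀ k, κ + (b k).rOut < c k * κ := by
    intro k
    change κ + min κ ℓ / 2 * (1 / ((k : ℝ) + 1)) < (1 + 1 / ((k : ℝ) + 1)) * κ
    nlinarith [hk0 k, hk1 k, min_le_left κ ℓ, mul_pos hκ (hk0 k)]
  have hc1 : ∀ k, 1 ≤ c k := fun k => by simp only [hc]; linarith [hk0 k]
  have hqi : IntegrableOn q (cylinder κ ℓ) := (Lp.memLp q).integrable (by norm_num)
  have hwi : ∀ i, IntegrableOn (fun x => w x i) (cylinder κ ℓ) := fun i =>
    (memLp_component w i).integrable (by norm_num)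
  have hwm : ∀ i, StronglyMeasurable fun x => w x i := fun i =>
    (EuclideanSpace.proj (𝕜 := ℂ) i).continuous.comp_stronglyMeasurable (Lp.stronglyMeasurable w)
  have htest := fun k => isPeriodicTest_mollify_dilation hκ hℓ hqi (b k)
    (by linarith [hc1 k] : 0 < c k) (hcb k)
  set φ : ℕ → E 3 → ℂ := fun k x => mollify κ ℓ q (bumpKernel (b k)) (dilation (c k) x) with hφ
  choose v hv using fun k => exists_L2Vec (κ := κ) (ℓ := ℓ) fun i =>
    memLp_cylinder_of_continuous (continuous_pderiv (htest k).1 i)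
  have hcomp : ∀ i, Tendsto (fun k => eLpNorm (fun x => v k x i - w x i) 2 μ) atTop (𝓝 0) := by
    intro i
    have hs := tendsto_scaled (κ := κ) (ℓ := ℓ) (a := fun k => ![c k, c k, 1] i)
      (memLp_component w i) (fun k => ?_)
      (tendsto_mollify_dilation hℓ (hwm i) (memLp_component w i) hc1 hclim hbℓ hblim) ?_
    · refine hs.congr fun k => eLpNorm_congr_ae ?_
      filter_upwards [hv k, ae_restrict_mem (measurableSet_cylinder κ ℓ)] with x hx hxm
      have hx2 : (dilation (c k) x) 2 = x 2 := by rw [dilation_apply]; rfl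
      rw [hx i, pderiv_comp_dilation (contDiff_mollify hℓ hqi (contDiff_bumpKernel (b k))
        (hasCompactSupport_bumpKernel (b k))), (h i).pderiv_mollify hℓ hqi (hwi i)
        (contDiff_bumpKernel (b k)) (hasCompactSupport_bumpKernel (b k))
        (fun v hv => bumpKernel_axial_eq_zero (hbℓ k) hv) (by rw [hx2]; exact hxm.2.1)
        (by rw [hx2]; exact hxm.2.2)]
    · exact ((contDiff_mollify hℓ (hwi i) (contDiff_bumpKernel (b k))
        (hasCompactSupport_bumpKernel (b k))).continuous.comp
        (dilation (c k)).continuous).aestronglyMeasurable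
    · fin_cases i
      · exact hclim
      · exact hclim
      · exact tendsto_const_nhds
  refine mem_closure_iff_seq_limit.2 ⟨v, fun k => ⟨φ k, htest k, hv k⟩, ?_⟩
  rw [tendsto_iff_edist_tendsto_0]
  refine tendsto_of_tendsto_of_tendsto_of_le_of_le tendsto_const_nhds ?_ (fun _ => zero_le)
    fun k => edist_le_sum_component (v k) w
  have := tendsto_finsetSum (Finset.univ : Finset (Fin 3)) fun i _ => hcomp i
  simpa using this

theorem coe_P0_orthogonal {κ ℓ : ℝ} (hκ : 0 < κ) (hℓ : 0 < ℓ) :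
    (((P0 κ ℓ)ᗮ : Submodule ℂ (L2Vec κ ℓ)) : Set (L2Vec κ ℓ)) =
      {w | ∃ q ∈ H1pZero κ ℓ, IsGradient q w} := by
  ext w
  rw [SetLike.mem_coe, P0_orthogonal hκ]
  constructor
  · exact exists_of_mem_closure hκ hℓ
  · rintro ⟨q, hq, hw⟩
    exact mem_closure_of_hasGreenDeriv hκ hℓ (hasGreenDeriv_of_mem_H1pZero hκ hℓ hq hw)

end Jet

end

theorem mainTheorem6 (κ ℓ : ℝ) (hκ : 0 < κ) (hℓ : 0 < ℓ) :
    (((Jet.P0 κ ℓ)ᗮ : Submodule ℂ (Jet.L2Vec κ ℓ)) : Set (Jet.L2Vec κ ℓ)) =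
        {w | ∃ q ∈ Jet.H1pZero κ ℓ, Jet.IsGradient q w} ∧
      ∀ w : Jet.L2Vec κ ℓ, ∃! p : Jet.L2Vec κ ℓ × Jet.L2 κ ℓ,
        p.1 ∈ Jet.P0 κ ℓ ∧ p.2 ∈ Jet.H1pZero κ ℓ ∧ Jet.IsGradient p.2 (w - p.1) := by
  have hperp := Jet.coe_P0_orthogonal hκ hℓ
  refine ⟨hperp, fun w => ?_⟩
  have hiff : ∀ v, v ∈ (Jet.P0 κ ℓ)ᗮ ↔ ∃ q ∈ Jet.H1pZero κ ℓ, Jet.IsGradient q v := fun v =>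
    Set.ext_iff.1 hperp v
  have hproj : ∃ u ∈ Jet.P0 κ ℓ, w - u ∈ (Jet.P0 κ ℓ)ᗮ := by
    rw [Jet.P0_eq_orthogonal hκ]
    exact ⟨_, Submodule.starProjection_apply_mem _ w, Submodule.sub_starProjection_mem_orthogonal w⟩
  obtain ⟨u, hu, hwu⟩ := hproj
  obtain ⟨q, hq, hgrad⟩ := (hiff _).1 hwu
  refine ⟨(u, q), ⟨hu, hq, hgrad⟩, ?_⟩
  rintro ⟨u', q'⟩ ⟨hu', hq', hgrad'⟩
  have hwu' := (hiff _).2 ⟨q', hq', hgrad'⟩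
  have huu : u' = u := by
    have h1 : u' - u ∈ Jet.P0 κ ℓ := Submodule.sub_mem _ hu' hu
    have h2 : u' - u ∈ (Jet.P0 κ ℓ)ᗮ := by
      have := Submodule.sub_mem _ hwu hwu'
      rwa [sub_sub_sub_cancel_left] at this
    have h3 : u' - u ∈ Jet.P0 κ ℓ ⊓ (Jet.P0 κ ℓ)ᗮ := ⟨h1, h2⟩
    rw [Submodule.inf_orthogonal_eq_bot, Submodule.mem_bot] at h3
    exact sub_eq_zero.1 h3
  subst huu
  exact Prod.ext rfl (Jet.eq_of_isGradient hκ hq' hq hgrad' hgrad)
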